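/- Let $\varepsilon\ge 0$ and $\Upsilon_\varepsilon=\left(\frac{e^\varepsilon-1}{e^\varepsilon+1}\right)^2$. A mechanism $\mathsf K$ from a measurable space $\mathcal X$ to a measurable space $\mathcal Z$ is a Markov kernel; it is $\varepsilon$-LDP if $\mathsf K(A|x)\le e^{\varepsilon}\,\mathsf K(A|x')$ for all measurable $A\subseteq\mathcal Z$ and all $x,x'\in\mathcal X$. For a probability measure $P$ on $\mathcal X$ let $P\mathsf K(A)=\int \mathsf K(A|x)\,P(\mathrm dx)$. For convex $f:[0,\infty)\to\mathbb R$ continuous at $0$ with $f(1)=0$ let $$D_f(P\|Q)=\int f\!\left(\tfrac{\mathrm dP}{\mathrm dQ}\right)\mathrm dQ+f'(\infty)\,P_s(\mathcal X)\in[0,\infty],$$ where $\frac{\mathrm dP}{\mathrm dQ}$ is the density of the part of $P$ that is absolutely continuous with respect to $Q$, $P_s$ is the part of $P$ singular to $Q$ (so $D_f(P\|Q)=\mathbb E_Q[f(\mathrm dP/\mathrm dQ)]$ if $P\ll Q$), $f'(\infty)=\lim_{t\to\infty}f(t)/t$ and $\infty\cdot 0=0$. Put $$\eta_f(\mathsf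 K)=\sup_{P\ne Q}\frac{D_f(P\mathsf K\|Q\mathsf K)}{D_f(P\|Q)},$$ the supremum over pairs of distinct probability measures on $\mathcal X$ (a quotient with denominator $\infty$ counts as $0$, and the supremum over no pairs is $0$). Write $\eta_{\mathsf{KL}},\eta_{\chi^2},\eta_{H^2}$ for $f(t)=t\log t$, $f(t)=t^2-1$, $f(t)=(1-\sqrt t)^2$, and $\chi^2(P\|Q)$ for $D_f(P\|Q)$ with $f(t)=t^2-1$. (1) For every $\varepsilon$-LDP mechanism $\mathsf K$, $$\eta_{\mathsf{KL}}(\mathsf K)=\eta_{\chi^2}(\mathsf K)=\eta_{H^2}(\mathsf K)\le\Upsilon_\varepsilon.$$ (2) The bound is attained: binary randomized response $\mathsf K$ on $\{0,1\}$, given by $\mathsf K(\cdot|1)=\mathrm{Bernoulli}(\kappa)$ and $\mathsf K(\cdot|0)=\mathrm{Bernoulli}(1-\kappa)$ with $\kappa=\frac{e^\varepsilon}{1+e^\varepsilon}$, is an $\varepsilon$-LDP mechanism with $\eta_{\mathsf{KL}}(\mathsf K)=\eta_{\chi^2}(\mathsf K)=\eta_{H^2}(\mathsf K)=\Upsilon_\varepsilon$.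 Moreover, for every $\alpha\in[0,1]$, with $P=\mathrm{Bernoulli}(\alpha)$ and $Q=\mathrm{Bernoulli}(1/2)$, one has $\chi^2(P\|Q)=(2\alpha-1)^2$ and $\chi^2(P\mathsf K\|Q\mathsf K)=\Upsilon_\varepsilon\,\chi^2(P\|Q)$. -/

import Mathlib

open MeasureTheory ProbabilityTheory
open scoped ENNReal

noncomputable section

namespace LDP

/-- The recession slope `f'(∞) = lim_{t → ∞} f t / t`, which exists in `(-∞, ∞]` for convex `f`. -/
def slopeAtTop (f : ℝ → ℝ) : EReal :=
  Filter.limsup (fun t : ℝ => ((f t / t : ℝ) : EReal)) Filter.atTop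

open Classical in
/-- The `f`-divergence `D_f(P‖Q)` of two probability measures, for `f` convex on `[0, ∞)`,
continuous at `0`, with `f 1 = 0`. If `P ≪ Q` it is `E_Q[f(dP/dQ)]`, and in general
`E_Q[f(dP/dQ)] + f'(∞) * Pₛ(X)`, with `Pₛ` the part of `P` singular to `Q`. For such `f` the negative
part of `f(dP/dQ)` is `Q`-integrable, so the expectation is `+∞` when `f(dP/dQ)` is not integrable;
the value is nonnegative by Jensen's inequality. -/
def fDiv {X : Type*} [MeasurableSpace X] (f : ℝ → ℝ) (P Q : Measure X) : ℝ≥0∞ :=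
  ((if Integrable (fun x => f (P.rnDeriv Q x).toReal) Q
      then ((∫ x, f (P.rnDeriv Q x).toReal ∂Q : ℝ) : EReal) else ⊤)
    + slopeAtTop f * ((P.singularPart Q Set.univ : ℝ≥0∞) : EReal)).toENNReal

/-- `f(t) = t log t`, the generator of the KL-divergence. -/
def fKL (t : ℝ) : ℝ := t * Real.log t

/-- `f(t) = t² - 1`, the generator of the `χ²`-divergence. -/
def fChiSq (t : ℝ) : ℝ := t ^ 2 - 1

/-- `f(t) = (1 - √t)²`, the generator of the squared Hellinger distance. -/
def fHellinger (t : ℝ) : ℝ := (1 - Real.sqrt t) ^ 2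

/-- The contraction coefficient `η_f(K)`: the supremum, over all pairs of distinct probability
measures `P ≠ Q`, of `D_f(PK‖QK) / D_f(P‖Q)`, where `PK` is the output distribution `K ∘ₘ P`.
(In `ℝ≥0∞` a quotient with denominator `∞` is `0`, so pairs with `D_f(P‖Q) = ∞` do not count; the
supremum over no pairs at all is `0`.) -/
def contractionCoeff {X Z : Type*} [MeasurableSpace X] [MeasurableSpace Z]
    (f : ℝ → ℝ) (K : Kernel X Z) : ℝ≥0∞ :=
  ⨆ (P : Measure X) (Q : Measure X) (_ : IsProbabilityMeasure P) (_ : IsProbabilityMeasure Q)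
    (_ : P ≠ Q), fDiv f (K ∘ₘ P) (K ∘ₘ Q) / fDiv f P Q

/-- `K` is `ε`-locally differentially private: `K(A|x) ≤ e^ε K(A|x')` for all events `A` and all
inputs `x, x'`. -/
def IsLDP {X Z : Type*} [MeasurableSpace X] [MeasurableSpace Z] (ε : ℝ) (K : Kernel X Z) : Prop :=
  ∀ (A : Set Z), MeasurableSet A → ∀ x x' : X, K x A ≤ ENNReal.ofReal (Real.exp ε) * K x' A

/-- `Υ_ε = ((e^ε - 1) / (e^ε + 1))²`. -/
def Upsilon (ε : ℝ) : ℝ := ((Real.exp ε - 1) / (Real.exp ε + 1)) ^ 2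

/-- `Bernoulli(p)` on `Bool`: `true` has probability `p`, `false` has probability `1 - p`. -/
def bern (p : unitInterval) : Measure Bool := bernoulliMeasure true false p

/-- `κ = e^ε / (1 + e^ε)`. -/
def rrParam (ε : ℝ) : unitInterval :=
  ⟨Real.exp ε / (1 + Real.exp ε), by positivity,
    (div_le_one (by positivity)).2 (by linarith [Real.exp_pos ε])⟩

/-- Binary randomized response: `K(·|1) = Bernoulli(κ)` and `K(·|0) = Bernoulli(1 - κ)` with
`κ = e^ε / (1 + e^ε)`. -/
def randomizedResponse (ε : ℝ) : Kernel Bool Bool :=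
  Kernel.ofFunOfCountable fun b =>
    if b then bern (rrParam ε) else bern (unitInterval.symm (rrParam ε))

/-- `Bernoulli(1/2)`. -/
def fairCoin : Measure Bool := bern ⟨1 / 2, by norm_num, by norm_num⟩

end LDP

end

namespace LDP

/-! Everything reduces to χ² through the Le Cam divergences LC_l(P‖Q) = ∫ (p - q)² / (l p + (1 - l)
q). Two facts drive the comparison. Up to the factor (1 - l)², LC_l(P‖Q) is χ²(P ‖ l P + (1 - l) Q)
(`leCamDiv_zero_mix`). KL and squared Hellinger are mixtures ∫ LC_l dν(l) over a finite nonzero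
measure ν on (0, 1) (`fDiv_fKL`, `fDiv_fHellinger`).

A kernel commutes with convex combinations of its inputs, so each LC_l contracts by at least the χ²
rate, and integrating over ν gives η_f ≤ η_χ² (`contractionCoeff_le_fChiSq`). For the converse,
replace P by d P + (1 - d) Q with d → 0: both sides become d² ν(ℝ) χ² to leading order. The privacy
bound keeps the output density below e^ε, which controls the error at the output
(`IsLDP.fChiSq_le_contractionCoeff`).

For the bound on η_χ², let u be the centred output density and φ(x) = ∫ u dK(·|x). Then χ²(PK‖QK) =
E_Q[φ (dP/dQ - 1)], so by Cauchy–Schwarz it suffices that E_Q[φ²] ≤ Υ_ε E_{QK}[u²]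
(`IsLDP.integral_sq_le`). As φ has mean zero, this follows from an inequality for pairs of inputs at
which φ has opposite signs (`two_point_variance_le`). Randomized response fixes the fair coin and
shrinks every bias by (e^ε - 1)/(e^ε + 1), which gives equality. -/

/-! ### f-divergences, recession slopes and Le Cam divergences -/

/-- A formula for `fDiv` in terms of the nonnegative function `g = f - a (t - 1)`. -/
theorem fDiv_eq_lintegral {X : Type*} [MeasurableSpace X] {f g : ℝ → ℝ} {a : ℝ} {σ : ℝ≥0∞}
    (hg : Measurable g) (hg0 : ∀ t, 0 ≤ t → 0 ≤ g t) (hfg : ∀ t, 0 ≤ t → f t = g t + a * (t - 1))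
    (hσ : slopeAtTop f = σ) (ha : σ = ⊤ ∨ a = 0) (P Q : Measure X) [IsProbabilityMeasure P]
    [IsProbabilityMeasure Q] :
    fDiv f P Q = ∫⁻ x, ENNReal.ofReal (g (P.rnDeriv Q x).toReal) ∂Q
      + σ * P.singularPart Q Set.univ := by
  classical
  have hr : Integrable (fun x => (P.rnDeriv Q x).toReal) Q := Measure.integrable_toReal_rnDeriv
  have hgm : Measurable fun x => g (P.rnDeriv Q x).toReal :=
    hg.comp (Measure.measurable_rnDeriv P Q).ennreal_toReal
  have hgnn : 0 ≤ fun x => g (P.rnDeriv Q x).toReal := fun x => hg0 _ ENNReal.toReal_nonneg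
  have hf : (fun x => f (P.rnDeriv Q x).toReal)
      = fun x => g (P.rnDeriv Q x).toReal + a * ((P.rnDeriv Q x).toReal - 1) :=
    funext fun x => hfg _ ENNReal.toReal_nonneg
  have hlin : Integrable (fun x => a * ((P.rnDeriv Q x).toReal - 1)) Q :=
    (hr.sub (integrable_const 1)).const_mul a
  have hiff : Integrable (fun x => f (P.rnDeriv Q x).toReal) Q
      ↔ Integrable (fun x => g (P.rnDeriv Q x).toReal) Q := by
    rw [hf]; exact integrable_add_iff_integrable_left hlin
  unfold fDiv
  rw [hσ]
  by_cases htop : σ = ⊤ ∧ P.singularPart Q Set.univ ≠ 0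
  · have h1 : (⊤ : ℝ≥0∞) * P.singularPart Q Set.univ = ⊤ := ENNReal.top_mul htop.2
    rw [htop.1, ← EReal.coe_ennreal_mul, h1, EReal.coe_ennreal_top, add_top]
    rw [EReal.add_top_of_ne_bot]
    · rfl
    · split_ifs
      · exact EReal.coe_ne_bot _
      · exact top_ne_bot
  -- The integral equals -a times the singular mass, so it vanishes if a = 0 or P ≪ Q. The remaining
  -- case, singular mass with infinite slope, has just been settled with both sides infinite.
  have hlin0 : ∫ x, a * ((P.rnDeriv Q x).toReal - 1) ∂Q = 0 := by
    by_cases ha0 : a = 0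
    · simp [ha0]
    have hs : P.singularPart Q Set.univ = 0 := by
      by_contra h
      exact htop ⟨ha.resolve_right ha0, h⟩
    have hac : P ≪ Q := by
      rw [← Measure.singularPart_eq_zero, ← Measure.measure_univ_eq_zero]; exact hs
    rw [integral_const_mul, integral_sub hr (integrable_const 1),
      Measure.integral_toReal_rnDeriv hac]
    simp
  have key : (if Integrable (fun x => f (P.rnDeriv Q x).toReal) Q
      then ((∫ x, f (P.rnDeriv Q x).toReal ∂Q : ℝ) : EReal) else ⊤)
      = ((∫⁻ x, ENNReal.ofReal (g (P.rnDeriv Q x).toReal) ∂Q : ℝ≥0∞) : EReal) := by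
    split_ifs with hint
    · have hgi := hiff.1 hint
      rw [hf, integral_add hgi hlin, hlin0, add_zero,
        ← ofReal_integral_eq_lintegral_ofReal hgi (Filter.Eventually.of_forall hgnn),
        EReal.coe_ennreal_ofReal, max_eq_left (integral_nonneg hgnn)]
    · have : ∫⁻ x, ENNReal.ofReal (g (P.rnDeriv Q x).toReal) ∂Q = ⊤ := by
        by_contra h
        refine hint (hiff.2 ⟨hgm.aestronglyMeasurable, ?_⟩)
        rw [hasFiniteIntegral_iff_ofReal (Filter.Eventually.of_forall hgnn)]
        exact lt_top_iff_ne_top.2 h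
      rw [this, EReal.coe_ennreal_top]
  rw [key, ← EReal.coe_ennreal_mul, ← EReal.coe_ennreal_add, EReal.toENNReal_coe]

/-- The function `(t - 1)² / (1 - l + l t)` generating the Le Cam divergence of parameter `l`. -/
noncomputable def leCamFun (l t : ℝ) : ℝ := (t - 1) ^ 2 / (1 - l + l * t)

/-- The Le Cam divergence `∫ (p - q)² / (l p + (1 - l) q)`. -/
noncomputable def leCamDiv {X : Type*} [MeasurableSpace X] (l : ℝ) (P Q : Measure X) : ℝ≥0∞ :=
  ∫⁻ x, ENNReal.ofReal (leCamFun l (P.rnDeriv Q x).toReal) ∂Q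
    + (ENNReal.ofReal l)⁻¹ * P.singularPart Q Set.univ

theorem measurable_leCamFun_uncurry : Measurable (Function.uncurry leCamFun) := by
  unfold leCamFun Function.uncurry; fun_prop

theorem leCamFun_nonneg {l t : ℝ} (hl : l ∈ Set.Icc (0 : ℝ) 1) (ht : 0 ≤ t) : 0 ≤ leCamFun l t := by
  have := mul_nonneg hl.1 ht
  exact div_nonneg (sq_nonneg _) (by linarith [hl.2])

theorem slopeAtTop_eq_top {f : ℝ → ℝ}
    (h : Filter.Tendsto (fun t => f t / t) Filter.atTop Filter.atTop) :
    slopeAtTop f = ((⊤ : ℝ≥0∞) : EReal) := by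
  rw [EReal.coe_ennreal_top]
  exact (EReal.tendsto_coe_nhds_top_iff.2 h).limsup_eq

theorem slopeAtTop_fChiSq : slopeAtTop fChiSq = ((⊤ : ℝ≥0∞) : EReal) := by
  apply slopeAtTop_eq_top
  have h : Filter.Tendsto (fun t : ℝ => t - 1) Filter.atTop Filter.atTop :=
    Filter.tendsto_atTop_add_const_right _ _ Filter.tendsto_id
  refine Filter.tendsto_atTop_mono' _ ?_ h
  filter_upwards [Filter.eventually_ge_atTop (1 : ℝ)] with t ht
  rw [fChiSq, le_div_iff₀ (by linarith)]
  nlinarith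

theorem slopeAtTop_fKL : slopeAtTop fKL = ((⊤ : ℝ≥0∞) : EReal) := by
  apply slopeAtTop_eq_top
  refine Real.tendsto_log_atTop.congr' ?_
  filter_upwards [Filter.eventually_gt_atTop (0 : ℝ)] with t ht
  rw [fKL, mul_div_cancel_left₀ _ ht.ne']

theorem slopeAtTop_fHellinger : slopeAtTop fHellinger = ((1 : ℝ≥0∞) : EReal) := by
  have h : Filter.Tendsto (fun t : ℝ => (1 - (Real.sqrt t)⁻¹) ^ 2) Filter.atTop (nhds 1) := by
    have := (tendsto_const_nhds (x := (1 : ℝ))).sub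
      (Filter.Tendsto.inv_tendsto_atTop Real.tendsto_sqrt_atTop)
    simpa using this.pow 2
  have h2 : Filter.Tendsto (fun t : ℝ => fHellinger t / t) Filter.atTop (nhds 1) := by
    refine h.congr' ?_
    filter_upwards [Filter.eventually_gt_atTop (0 : ℝ)] with t ht
    have hs : Real.sqrt t ≠ 0 := (Real.sqrt_pos.2 ht).ne'
    have ht2 : t = Real.sqrt t ^ 2 := (Real.sq_sqrt ht.le).symm
    rw [fHellinger, eq_div_iff ht.ne']
    nth_rw 2 [ht2]
    field_simp
    ring
  have := ((continuous_coe_real_ereal.tendsto 1).comp h2).limsup_eq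
  rw [EReal.coe_ennreal_one]
  exact this

/-- Here t² - 1 = (t - 1)² + 2 (t - 1). The inverse of 0 in `ℝ≥0∞` is `⊤`, so l = 0 also carries the
infinite recession slope. -/
theorem fDiv_fChiSq {X : Type*} [MeasurableSpace X] (P Q : Measure X) [IsProbabilityMeasure P]
    [IsProbabilityMeasure Q] : fDiv fChiSq P Q = leCamDiv 0 P Q := by
  rw [fDiv_eq_lintegral (g := leCamFun 0) (a := 2) (σ := ⊤) (by unfold leCamFun; fun_prop)
    (fun t ht => leCamFun_nonneg (by simp) ht) (fun t _ => by simp [fChiSq, leCamFun]; ring)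
    slopeAtTop_fChiSq (Or.inl rfl), leCamDiv]
  simp

/-- If `f` is, up to a linear term, a mixture of the functions `leCamFun l`, then `fDiv f` is a
mixture of Le Cam divergences. -/
theorem fDiv_eq_lintegral_leCamDiv {X : Type*} [MeasurableSpace X] {f g : ℝ → ℝ} {a : ℝ}
    {σ : ℝ≥0∞} {ν : Measure ℝ} [SFinite ν]
    (hg : Measurable g) (hg0 : ∀ t, 0 ≤ t → 0 ≤ g t) (hfg : ∀ t, 0 ≤ t → f t = g t + a * (t - 1))
    (hσ : slopeAtTop f = σ) (ha : σ = ⊤ ∨ a = 0)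
    (hν : ∀ t, 0 ≤ t → ENNReal.ofReal (g t) = ∫⁻ l, ENNReal.ofReal (leCamFun l t) ∂ν)
    (hσν : σ = ∫⁻ l, (ENNReal.ofReal l)⁻¹ ∂ν) (P Q : Measure X) [IsProbabilityMeasure P]
    [IsProbabilityMeasure Q] :
    fDiv f P Q = ∫⁻ l, leCamDiv l P Q ∂ν := by
  rw [fDiv_eq_lintegral hg hg0 hfg hσ ha]
  unfold leCamDiv
  -- The recession slope of `leCamFun l` is 1/l, so `hσν` matches the singular terms; Tonelli
  -- matches the rest.
  rw [lintegral_add_right _ (by fun_prop), lintegral_mul_const _ (by fun_prop), ← hσν]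
  congr 1
  simp_rw [hν _ ENNReal.toReal_nonneg]
  refine lintegral_lintegral_swap (Measurable.aemeasurable ?_)
  exact (measurable_leCamFun_uncurry.comp (measurable_snd.prodMk
    ((Measure.measurable_rnDeriv P Q).ennreal_toReal.comp measurable_fst))).ennreal_ofReal

theorem measurable_leCamDiv {X : Type*} [MeasurableSpace X] (P Q : Measure X) [SFinite Q] :
    Measurable fun l => leCamDiv l P Q := by
  unfold leCamDiv
  refine Measurable.add ?_ (by fun_prop)
  refine Measurable.lintegral_prod_right'
    (f := fun p : ℝ × X => ENNReal.ofReal (leCamFun p.1 (P.rnDeriv Q p.2).toReal)) ?_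
  exact (measurable_leCamFun_uncurry.comp (measurable_fst.prodMk
    ((Measure.measurable_rnDeriv P Q).ennreal_toReal.comp measurable_snd))).ennreal_ofReal

/-! ### Le Cam divergence as χ² against a mixture -/

/-- The convex combination `l P + (1 - l) Q`. -/
noncomputable def mix {X : Type*} [MeasurableSpace X] (l : ℝ) (P Q : Measure X) : Measure X :=
  ENNReal.ofReal l • P + ENNReal.ofReal (1 - l) • Q

theorem isProbabilityMeasure_mix {X : Type*} [MeasurableSpace X] {l : ℝ}
    (hl : l ∈ Set.Icc (0 : ℝ) 1) (P Q : Measure X) [IsProbabilityMeasure P]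
    [IsProbabilityMeasure Q] : IsProbabilityMeasure (mix l P Q) := by
  constructor
  simp only [mix, Measure.add_apply, Measure.smul_apply, measure_univ, smul_eq_mul, mul_one]
  rw [← ENNReal.ofReal_add hl.1 (by linarith [hl.2])]
  simp

theorem comp_mix {X Z : Type*} [MeasurableSpace X] [MeasurableSpace Z] (l : ℝ) (P Q : Measure X)
    (K : Kernel X Z) : K ∘ₘ mix l P Q = mix l (K ∘ₘ P) (K ∘ₘ Q) := by
  rw [mix, mix, Measure.comp_add, Measure.comp_smul, Measure.comp_smul]

theorem eq_of_mix_eq {X : Type*} [MeasurableSpace X] {l : ℝ} (hl : l ∈ Set.Ioo (0 : ℝ) 1)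
    {P Q : Measure X} [IsProbabilityMeasure P] [IsProbabilityMeasure Q]
    (h : mix l P Q = P ∨ mix l P Q = Q) : P = Q := by
  have h1 : 0 < 1 - l := by linarith [hl.2]
  have key : ∀ A, (mix l P Q).real A = l * P.real A + (1 - l) * Q.real A := by
    intro A
    have hP : ENNReal.ofReal l * P A ≠ ⊤ :=
      ENNReal.mul_ne_top ENNReal.ofReal_ne_top (measure_ne_top _ _)
    have hQ : ENNReal.ofReal (1 - l) * Q A ≠ ⊤ :=
      ENNReal.mul_ne_top ENNReal.ofReal_ne_top (measure_ne_top _ _)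
    simp only [Measure.real, mix, Measure.add_apply, Measure.smul_apply, smul_eq_mul]
    rw [ENNReal.toReal_add hP hQ, ENNReal.toReal_mul, ENNReal.toReal_mul,
      ENNReal.toReal_ofReal hl.1.le, ENNReal.toReal_ofReal h1.le]
  refine Measure.ext fun A _ => ?_
  rw [← measureReal_eq_measureReal_iff]
  have hA := key A
  rcases h with h | h <;> rw [h] at hA
  · have : (1 - l) * (P.real A - Q.real A) = 0 := by linarith
    linarith [(mul_eq_zero.1 this).resolve_left h1.ne']
  · have : l * (P.real A - Q.real A) = 0 := by linarith
    linarith [(mul_eq_zero.1 this).resolve_left hl.1.ne']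

/-- The singular coefficient is never 0, so P ≪ Q; for l < 1 the denominator is positive, so the
integrand vanishes only where the density is 1. -/
theorem eq_of_leCamDiv_eq_zero {X : Type*} [MeasurableSpace X] {l : ℝ}
    (hl : l ∈ Set.Ico (0 : ℝ) 1) {P Q : Measure X} [IsProbabilityMeasure P]
    [IsProbabilityMeasure Q] (h : leCamDiv l P Q = 0) : P = Q := by
  rw [leCamDiv, add_eq_zero, mul_eq_zero] at h
  have hs := h.2.resolve_left (by simp)
  have hac : P ≪ Q := by
    rw [← Measure.singularPart_eq_zero, ← Measure.measure_univ_eq_zero]; exact hs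
  have hm : Measurable fun x => ENNReal.ofReal (leCamFun l (P.rnDeriv Q x).toReal) :=
    ((measurable_leCamFun_uncurry.comp measurable_prodMk_left).comp
      (Measure.measurable_rnDeriv P Q).ennreal_toReal).ennreal_ofReal
  have h0 := (lintegral_eq_zero_iff hm).1 h.1
  have h1 : P.rnDeriv Q =ᵐ[Q] 1 := by
    filter_upwards [h0, Measure.rnDeriv_ne_top P Q] with x hx hxt
    have hpos : 0 < 1 - l + l * (P.rnDeriv Q x).toReal := by
      have := mul_nonneg hl.1 (ENNReal.toReal_nonneg (a := P.rnDeriv Q x))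
      linarith [hl.2]
    have h2 : leCamFun l (P.rnDeriv Q x).toReal = 0 :=
      le_antisymm (ENNReal.ofReal_eq_zero.1 hx)
        (leCamFun_nonneg ⟨hl.1, hl.2.le⟩ ENNReal.toReal_nonneg)
    rw [leCamFun, div_eq_zero_iff, or_iff_left hpos.ne', sq_eq_zero_iff, sub_eq_zero] at h2
    rw [Pi.one_apply, ← ENNReal.ofReal_toReal hxt, h2, ENNReal.ofReal_one]
  rw [← Measure.withDensity_rnDeriv_eq P Q hac, withDensity_congr_ae h1, withDensity_one]

theorem leCamDiv_self {X : Type*} [MeasurableSpace X] (l : ℝ) (P : Measure X)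
    [IsProbabilityMeasure P] : leCamDiv l P P = 0 := by
  have h : ∫⁻ x, ENNReal.ofReal (leCamFun l (P.rnDeriv P x).toReal) ∂P = 0 := by
    rw [lintegral_congr_ae (g := fun _ => 0), lintegral_zero]
    filter_upwards [Measure.rnDeriv_self P] with x hx
    simp [hx, leCamFun]
  rw [leCamDiv, h, (Measure.singularPart_eq_zero P P).2 .rfl]
  simp

/-- Since (t - 1)² ≤ (1 + t)² and 1 - l + l t ≥ min(l, 1 - l) (1 + t), the generator grows at most
linearly in the density. -/
theorem leCamDiv_ne_top {X : Type*} [MeasurableSpace X] {l : ℝ}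
    (hl : l ∈ Set.Ioo (0 : ℝ) 1) (P Q : Measure X) [IsProbabilityMeasure P]
    [IsProbabilityMeasure Q] : leCamDiv l P Q ≠ ⊤ := by
  refine ENNReal.add_ne_top.2 ⟨?_, ENNReal.mul_ne_top ?_ (measure_ne_top _ _)⟩
  · set m := min l (1 - l)
    have hm : 0 < m := lt_min hl.1 (by linarith [hl.2])
    have hint : Integrable (fun x => (1 + (P.rnDeriv Q x).toReal) / m) Q :=
      ((integrable_const 1).add Measure.integrable_toReal_rnDeriv).div_const m
    refine ne_top_of_le_ne_top hint.lintegral_lt_top.ne (lintegral_mono fun x => ?_)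
    refine ENNReal.ofReal_le_ofReal ?_
    have ht : 0 ≤ (P.rnDeriv Q x).toReal := ENNReal.toReal_nonneg
    generalize (P.rnDeriv Q x).toReal = t at ht
    have h1 : m * (1 + t) ≤ 1 - l + l * t := by
      have a1 : m ≤ 1 - l := min_le_right _ _
      have a2 : m * t ≤ l * t := mul_le_mul_of_nonneg_right (min_le_left _ _) ht
      linarith
    have h2 : 0 < m * (1 + t) := by positivity
    rw [leCamFun, div_le_div_iff₀ (by linarith) hm]
    have h3 : (t - 1) ^ 2 ≤ (1 + t) ^ 2 := by nlinarith
    calc (t - 1) ^ 2 * m ≤ (1 + t) ^ 2 * m := mul_le_mul_of_nonneg_right h3 hm.le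
      _ = (1 + t) * (m * (1 + t)) := by ring
      _ ≤ (1 + t) * (1 - l + l * t) := mul_le_mul_of_nonneg_left h1 (by linarith)
  · simpa using hl.1

/-- With R = dP/dQ, the density g of P relative to the mixture is R / (1 - l + l R) on the
absolutely continuous part and 1/l on the singular part. Hence g - 1 = (1 - l)(R - 1) / (1 - l + l
R) on the former, and squaring against the mixture leaves one factor of the denominator. On the
latter, l (1/l - 1)² = (1 - l)² / l. -/
theorem leCamDiv_zero_mix {X : Type*} [MeasurableSpace X] {l : ℝ}
    (hl : l ∈ Set.Ioo (0 : ℝ) 1) (P Q : Measure X) [IsProbabilityMeasure P]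
    [IsProbabilityMeasure Q] :
    leCamDiv 0 P (mix l P Q) = ENNReal.ofReal ((1 - l) ^ 2) * leCamDiv l P Q := by
  classical
  have h1 : 0 < 1 - l := by linarith [hl.2]
  have hl0 := hl.1
  have := isProbabilityMeasure_mix ⟨hl.1.le, hl.2.le⟩ P Q
  obtain ⟨S, hS, hS1, hS2⟩ := Measure.mutuallySingular_singularPart P Q
  set R := P.rnDeriv Q with hR
  have hRm : Measurable R := Measure.measurable_rnDeriv P Q
  set Ps := P.singularPart Q with hPs
  have hdec : P = Ps + Q.withDensity R := (Measure.singularPart_add_rnDeriv P Q).symm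
  -- the density of `P` with respect to the mixture
  set g : X → ℝ≥0∞ := fun x => if x ∈ S
    then ENNReal.ofReal ((R x).toReal / (1 - l + l * (R x).toReal)) else (ENNReal.ofReal l)⁻¹
    with hg
  have hgm : Measurable g :=
    Measurable.ite hS (by fun_prop) measurable_const
  have hgPs : g =ᵐ[Ps] fun _ => (ENNReal.ofReal l)⁻¹ := by
    filter_upwards [measure_eq_zero_iff_ae_notMem.1 hS1] with x hx
    simp [hg, hx]
  have hgQ : g =ᵐ[Q] fun x => ENNReal.ofReal ((R x).toReal / (1 - l + l * (R x).toReal)) := by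
    filter_upwards [measure_eq_zero_iff_ae_notMem.1 hS2] with x hx
    have : x ∈ S := by simpa using hx
    simp [hg, this]
  have hlne : ENNReal.ofReal l ≠ 0 := by simpa using hl0
  have hlint : ∀ h : X → ℝ≥0∞, Measurable h → ∫⁻ x, h x ∂(mix l P Q)
      = ENNReal.ofReal l * ∫⁻ x, h x ∂Ps
        + ∫⁻ x, ENNReal.ofReal (1 - l + l * (R x).toReal) * h x ∂Q := by
    intro h hh
    rw [mix, lintegral_add_measure, lintegral_smul_measure, lintegral_smul_measure]
    nth_rw 1 [hdec]
    rw [lintegral_add_measure, lintegral_withDensity_eq_lintegral_mul _ hRm hh, smul_eq_mul,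
      smul_eq_mul, mul_add, add_assoc, ← lintegral_const_mul (f := R * h) _ (hRm.mul hh),
      ← lintegral_const_mul (ENNReal.ofReal (1 - l)) hh, ← lintegral_add_left ((hRm.mul hh).const_mul _)]
    congr 1
    refine lintegral_congr_ae ?_
    filter_upwards [Measure.rnDeriv_ne_top P Q] with x hx
    have : ENNReal.ofReal (1 - l + l * (R x).toReal)
        = ENNReal.ofReal (1 - l) + ENNReal.ofReal l * R x := by
      rw [ENNReal.ofReal_add h1.le (by positivity), ENNReal.ofReal_mul hl0.le,
        ENNReal.ofReal_toReal hx]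
    rw [this, Pi.mul_apply]
    ring
  have hPg : P = (mix l P Q).withDensity g := by
    refine Measure.ext fun A hA => ?_
    rw [withDensity_apply _ hA, ← lintegral_indicator hA, hlint _ (hgm.indicator hA)]
    have e1 : ∫⁻ x, A.indicator g x ∂Ps = (ENNReal.ofReal l)⁻¹ * Ps A := by
      rw [lintegral_indicator hA, lintegral_congr_ae (ae_restrict_of_ae hgPs)]
      simp
    have e2 : ∫⁻ x, ENNReal.ofReal (1 - l + l * (R x).toReal) * A.indicator g x ∂Q
        = ∫⁻ x in A, R x ∂Q := by
      rw [← lintegral_indicator hA]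
      refine lintegral_congr_ae ?_
      filter_upwards [hgQ, Measure.rnDeriv_ne_top P Q] with x hx hxt
      by_cases hxA : x ∈ A
      · have hpos : 0 < 1 - l + l * (R x).toReal := by positivity
        rw [Set.indicator_of_mem hxA, Set.indicator_of_mem hxA, hx, ← ENNReal.ofReal_mul hpos.le,
          mul_div_cancel₀ _ hpos.ne', ENNReal.ofReal_toReal hxt]
      · simp [hxA]
    rw [e1, e2, ← mul_assoc, ENNReal.mul_inv_cancel hlne ENNReal.ofReal_ne_top, one_mul,
      ← withDensity_apply _ hA, ← Measure.add_apply, ← hdec]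
  have hac : P ≪ mix l P Q := by
    nth_rw 1 [hPg]; exact withDensity_absolutelyContinuous _ _
  have hrn : P.rnDeriv (mix l P Q) =ᵐ[mix l P Q] g := by
    have := Measure.rnDeriv_withDensity (mix l P Q) hgm
    rwa [← hPg] at this
  rw [leCamDiv, (Measure.singularPart_eq_zero _ _).2 hac]
  have e3 : ∫⁻ x, ENNReal.ofReal (leCamFun 0 (P.rnDeriv (mix l P Q) x).toReal) ∂(mix l P Q)
      = ∫⁻ x, ENNReal.ofReal (((g x).toReal - 1) ^ 2) ∂(mix l P Q) := by
    refine lintegral_congr_ae ?_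
    filter_upwards [hrn] with x hx
    simp [hx, leCamFun]
  have e4 : ∫⁻ x, ENNReal.ofReal (((g x).toReal - 1) ^ 2) ∂Ps
      = ENNReal.ofReal ((l⁻¹ - 1) ^ 2) * Ps Set.univ := by
    rw [← lintegral_const]
    refine lintegral_congr_ae ?_
    filter_upwards [hgPs] with x hx
    rw [hx, ENNReal.toReal_inv, ENNReal.toReal_ofReal hl0.le]
  have e5 : ∫⁻ x, ENNReal.ofReal (1 - l + l * (R x).toReal)
        * ENNReal.ofReal (((g x).toReal - 1) ^ 2) ∂Q
      = ENNReal.ofReal ((1 - l) ^ 2) * ∫⁻ x, ENNReal.ofReal (leCamFun l (R x).toReal) ∂Q := by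
    rw [← lintegral_const_mul']
    · refine lintegral_congr_ae ?_
      filter_upwards [hgQ] with x hx
      have hpos : 0 < 1 - l + l * (R x).toReal := by positivity
      rw [hx, ENNReal.toReal_ofReal (by positivity), ← ENNReal.ofReal_mul hpos.le,
        ← ENNReal.ofReal_mul (by positivity), leCamFun]
      congr 1
      field_simp
      ring
    · exact ENNReal.ofReal_ne_top
  rw [e3, hlint _ (by fun_prop), e4, e5, leCamDiv, mul_add, ← mul_assoc, ← mul_assoc,
    ← ENNReal.ofReal_mul hl0.le, ← ENNReal.ofReal_inv_of_pos hl0, ← ENNReal.ofReal_mul (by positivity)]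
  have e6 : l * (l⁻¹ - 1) ^ 2 = (1 - l) ^ 2 * l⁻¹ := by field_simp
  rw [e6]
  simp [add_comm, hR, hPs]

/-- At t = 2 the generators are 1 / (1 + l) ≥ 1/2, while their integral is finite. Finiteness later
permits cancelling the total mass. -/
theorem measure_univ_ne_top_of_lintegral_leCamFun {g : ℝ → ℝ} {ν : Measure ℝ}
    (hmem : ∀ᵐ l ∂ν, l ∈ Set.Ioo (0 : ℝ) 1)
    (hν : ∀ t, 0 ≤ t → ENNReal.ofReal (g t) = ∫⁻ l, ENNReal.ofReal (leCamFun l t) ∂ν) :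
    ν Set.univ ≠ ⊤ := by
  intro h
  have h1 : ∫⁻ _, ENNReal.ofReal (1 / 2) ∂ν ≤ ∫⁻ l, ENNReal.ofReal (leCamFun l 2) ∂ν := by
    refine lintegral_mono_ae ?_
    filter_upwards [hmem] with l hl
    refine ENNReal.ofReal_le_ofReal ?_
    rw [leCamFun, div_le_div_iff₀ (by norm_num) (by linarith [hl.1])]
    linarith [hl.2]
  rw [lintegral_const, h, ENNReal.mul_top (by simp), ← hν 2 (by norm_num)] at h1
  exact ENNReal.ofReal_ne_top (top_le_iff.1 h1)

/-! ### KL divergence as a mixture of Le Cam divergences -/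

/-- The mixing measure of the Kullback-Leibler divergence. -/
noncomputable def klMixing : Measure ℝ :=
  (volume.restrict (Set.Ioo (0 : ℝ) 1)).withDensity fun l => ENNReal.ofReal (1 - l)

instance : SFinite klMixing := by unfold klMixing; infer_instance

theorem lintegral_klMixing {h : ℝ → ℝ≥0∞} (hh : Measurable h) :
    ∫⁻ l, h l ∂klMixing = ∫⁻ l in Set.Ioo (0 : ℝ) 1, ENNReal.ofReal (1 - l) * h l := by
  rw [klMixing, lintegral_withDensity_eq_lintegral_mul _ (by fun_prop) hh]
  rfl

theorem klMixing_mem : ∀ᵐ l ∂klMixing, l ∈ Set.Ioo (0 : ℝ) 1 :=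
  (withDensity_absolutelyContinuous _ _).ae_le (ae_restrict_mem measurableSet_Ioo)

/-- The nonnegative generator `t log t - t + 1` of the Kullback-Leibler divergence. -/
noncomputable def klGen (t : ℝ) : ℝ := t * Real.log t - (t - 1)

theorem integral_klGen {t : ℝ} (ht : 0 < t) :
    ∫ s in (0 : ℝ)..1, (1 - s) * leCamFun s t = klGen t := by
  have hpos : ∀ s ∈ Set.uIcc (0 : ℝ) 1, 0 < 1 - s + s * t := by
    intro s hs
    rw [Set.uIcc_of_le zero_le_one] at hs
    rcases hs.1.eq_or_lt with h | h
    · rw [← h]; norm_num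
    · have := mul_pos h ht
      linarith [hs.2]
  -- Division in s gives (1 - s)(t - 1)² / (1 - s + s t) = -(t - 1) + t (t - 1) / (1 - s + s t).
  have hderiv : ∀ s ∈ Set.uIcc (0 : ℝ) 1,
      HasDerivAt (fun s => -(t - 1) * s + t * Real.log (1 - s + s * t))
        ((1 - s) * leCamFun s t) s := by
    intro s hs
    have h1 : HasDerivAt (fun s : ℝ => 1 - s + s * t) (-1 + 1 * t) s :=
      ((hasDerivAt_id s).const_sub 1).add ((hasDerivAt_id s).mul_const t)
    have h2 := ((hasDerivAt_id s).const_mul (-(t - 1))).add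
      ((h1.log (hpos s hs).ne').const_mul t)
    refine h2.congr_deriv ?_
    have := (hpos s hs).ne'
    rw [leCamFun, mul_div_assoc', mul_div_assoc', eq_div_iff this, add_mul,
      div_mul_cancel₀ _ this]
    ring
  rw [intervalIntegral.integral_eq_sub_of_hasDerivAt hderiv]
  · simp [klGen]; ring
  · refine ContinuousOn.intervalIntegrable fun s hs => ContinuousAt.continuousWithinAt ?_
    have := (hpos s hs).ne'
    unfold leCamFun
    fun_prop (disch := assumption)

theorem lintegral_klMixing_leCamFun (t : ℝ) (ht : 0 ≤ t) :
    ENNReal.ofReal (klGen t) = ∫⁻ l, ENNReal.ofReal (leCamFun l t) ∂klMixing := by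
  have hm : Measurable fun l => leCamFun l t :=
    measurable_leCamFun_uncurry.comp measurable_prodMk_right
  rw [lintegral_klMixing hm.ennreal_ofReal]
  have hmul : ∀ l ∈ Set.Ioo (0 : ℝ) 1, ENNReal.ofReal (1 - l) * ENNReal.ofReal (leCamFun l t)
      = ENNReal.ofReal ((1 - l) * leCamFun l t) := fun l hl =>
    (ENNReal.ofReal_mul (by linarith [hl.2])).symm
  rw [setLIntegral_congr_fun measurableSet_Ioo hmul]
  rcases ht.eq_or_lt with h | h
  -- At t = 0 the logarithmic primitive breaks down at the endpoint 1, but the weight 1 - l cancels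
  -- the pole of 1 / (1 - l) and the integrand is 1.
  · have h1 : ∀ l ∈ Set.Ioo (0 : ℝ) 1, ENNReal.ofReal ((1 - l) * leCamFun l t) = 1 := by
      intro l hl
      have : (1 - l) ≠ 0 := by linarith [hl.2]
      rw [leCamFun, ← h]
      simp [this]
    rw [setLIntegral_congr_fun measurableSet_Ioo h1, ← h]
    simp [klGen]
  · have hnn : ∀ l ∈ Set.Ioo (0 : ℝ) 1, 0 ≤ (1 - l) * leCamFun l t := fun l hl =>
      mul_nonneg (by linarith [hl.2]) (leCamFun_nonneg ⟨hl.1.le, hl.2.le⟩ ht)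
    rw [← integral_klGen h, intervalIntegral.integral_of_le zero_le_one,
      integral_Ioc_eq_integral_Ioo, ofReal_integral_eq_lintegral_ofReal]
    · refine Integrable.mono' (g := fun _ => (t - 1) ^ 2 / min 1 t)
        (integrableOn_const (by simp)) (by fun_prop) ?_
      filter_upwards [ae_restrict_mem measurableSet_Ioo] with l hl
      have hmin : 0 < min 1 t := lt_min one_pos h
      have h1 : min 1 t ≤ 1 - l + l * t := by
        have a1 := mul_le_mul_of_nonneg_left (min_le_left 1 t) (by linarith [hl.2] : 0 ≤ 1 - l)
        have a2 := mul_le_mul_of_nonneg_left (min_le_right 1 t) hl.1.le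
        linarith
      rw [Real.norm_of_nonneg (hnn l hl)]
      calc (1 - l) * leCamFun l t ≤ 1 * leCamFun l t :=
            mul_le_mul_of_nonneg_right (by linarith [hl.1])
              (leCamFun_nonneg ⟨hl.1.le, hl.2.le⟩ ht)
        _ ≤ _ := by
          rw [one_mul, leCamFun]
          exact div_le_div_of_nonneg_left (sq_nonneg _) hmin h1
    · filter_upwards [ae_restrict_mem measurableSet_Ioo] with l hl using hnn l hl

theorem klGen_nonneg (t : ℝ) (ht : 0 ≤ t) : 0 ≤ klGen t := by
  rcases ht.eq_or_lt with h | h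
  · rw [← h]; simp [klGen]
  · have h1 := Real.log_le_sub_one_of_pos (inv_pos.2 h)
    rw [Real.log_inv] at h1
    have h2 := mul_le_mul_of_nonneg_left h1 ht
    rw [mul_sub, mul_inv_cancel₀ h.ne'] at h2
    unfold klGen
    linarith

/-- Pointwise `leCamFun l t` / t ≤ 1/l, so the integral dominates `klGen t` / t for every t ≥ 1; at
t = e^(r + 1) this quotient is r + 1/t. -/
theorem lintegral_klMixing_inv : (⊤ : ℝ≥0∞) = ∫⁻ l, (ENNReal.ofReal l)⁻¹ ∂klMixing := by
  symm
  refine ENNReal.eq_top_of_forall_nnreal_le fun r => ?_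
  set t := Real.exp (r + 1) with ht
  have ht0 : 0 < t := Real.exp_pos _
  have ht1 : 1 ≤ t := Real.one_le_exp (by positivity)
  have h1 : (r : ℝ≥0∞) ≤ ENNReal.ofReal (t⁻¹) * ENNReal.ofReal (klGen t) := by
    rw [← ENNReal.ofReal_mul (by positivity), ← ENNReal.ofReal_coe_nnreal]
    refine ENNReal.ofReal_le_ofReal ?_
    rw [klGen, ht, Real.log_exp, ← ht]
    have : t⁻¹ * (t * (r + 1) - (t - 1)) = r + t⁻¹ := by field_simp; ring
    rw [this]
    have := inv_pos.2 ht0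
    linarith
  refine h1.trans ?_
  rw [lintegral_klMixing_leCamFun t ht0.le, ← lintegral_const_mul' _ _ ENNReal.ofReal_ne_top]
  refine lintegral_mono_ae ?_
  filter_upwards [klMixing_mem] with l hl
  have hl0 := hl.1
  rw [← ENNReal.ofReal_inv_of_pos hl.1, ← ENNReal.ofReal_mul (by positivity)]
  refine ENNReal.ofReal_le_ofReal ?_
  have hpos : 0 < 1 - l + l * t := by nlinarith [hl.2]
  rw [leCamFun, ← div_eq_inv_mul, div_div, inv_eq_one_div, div_le_div_iff₀ (by positivity) hl0]
  nlinarith [hl.2]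

theorem fDiv_fKL {X : Type*} [MeasurableSpace X] (P Q : Measure X) [IsProbabilityMeasure P]
    [IsProbabilityMeasure Q] : fDiv fKL P Q = ∫⁻ l, leCamDiv l P Q ∂klMixing :=
  fDiv_eq_lintegral_leCamDiv (g := klGen) (a := 1) (by unfold klGen; fun_prop) klGen_nonneg
    (fun t _ => by simp [fKL, klGen]) slopeAtTop_fKL (Or.inl rfl) lintegral_klMixing_leCamFun
    lintegral_klMixing_inv P Q

/-! ### Squared Hellinger distance as a mixture of Le Cam divergences -/

/-- The mixing measure of the squared Hellinger distance, in the parametrization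
`l = s² / (1 + s²)`. -/
noncomputable def hellingerMixing : Measure ℝ :=
  ((volume.restrict (Set.Ioi (0 : ℝ))).withDensity
    fun s => ENNReal.ofReal (4 / Real.pi * (s ^ 2 / (1 + s ^ 2) ^ 3))).map
    fun s => s ^ 2 / (1 + s ^ 2)

instance : SFinite hellingerMixing := by unfold hellingerMixing; infer_instance

theorem lintegral_hellingerMixing {h : ℝ → ℝ≥0∞} (hh : Measurable h) :
    ∫⁻ l, h l ∂hellingerMixing = ∫⁻ s in Set.Ioi (0 : ℝ),
      ENNReal.ofReal (4 / Real.pi * (s ^ 2 / (1 + s ^ 2) ^ 3)) * h (s ^ 2 / (1 + s ^ 2)) := by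
  have hm : Measurable fun s : ℝ => s ^ 2 / (1 + s ^ 2) := by fun_prop
  rw [hellingerMixing, lintegral_map hh hm]
  exact lintegral_withDensity_eq_lintegral_mul _ (by fun_prop) (hh.comp hm)

theorem hellingerMixing_mem : ∀ᵐ l ∂hellingerMixing, l ∈ Set.Ioo (0 : ℝ) 1 := by
  refine (ae_map_iff (p := fun l => l ∈ Set.Ioo (0 : ℝ) 1) (by fun_prop) measurableSet_Ioo).2 ?_
  refine (withDensity_absolutelyContinuous _ _).ae_le ?_
  filter_upwards [ae_restrict_mem measurableSet_Ioi] with s hs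
  have hs0 : 0 < s := hs
  exact ⟨by positivity, (div_lt_one (by positivity)).2 (by linarith)⟩

theorem tendsto_div_one_add_sq :
    Filter.Tendsto (fun s : ℝ => s / (1 + s ^ 2)) Filter.atTop (nhds 0) := by
  refine squeeze_zero' ?_ ?_ tendsto_inv_atTop_zero
  · filter_upwards [Filter.eventually_gt_atTop 0] with s hs using by positivity
  · filter_upwards [Filter.eventually_gt_atTop 0] with s hs
    rw [div_le_iff₀ (by positivity)]
    have : s⁻¹ * (1 + s ^ 2) = s⁻¹ + s := by field_simp
    rw [this]
    have := inv_pos.2 hs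
    linarith

theorem hasDerivAt_div_one_add_sq (s : ℝ) :
    HasDerivAt (fun s : ℝ => s / (1 + s ^ 2)) ((1 - s ^ 2) / (1 + s ^ 2) ^ 2) s := by
  have h : HasDerivAt (fun s : ℝ => 1 + s ^ 2) (2 * s) s := by
    simpa using (hasDerivAt_pow 2 s).const_add 1
  refine ((hasDerivAt_id s).div h (by positivity)).congr_deriv ?_
  simp only [id]
  ring

theorem setLIntegral_Ioi_of_hasDerivAt {F F' : ℝ → ℝ} {m : ℝ}
    (hderiv : ∀ s, HasDerivAt F (F' s) s) (hpos : ∀ s ∈ Set.Ioi (0 : ℝ), 0 ≤ F' s)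
    (hlim : Filter.Tendsto F Filter.atTop (nhds m)) :
    ∫⁻ s in Set.Ioi (0 : ℝ), ENNReal.ofReal (F' s) = ENNReal.ofReal (m - F 0) := by
  have hc := (hderiv 0).continuousAt.continuousWithinAt (s := Set.Ici 0)
  rw [← integral_Ioi_of_hasDerivAt_of_nonneg hc (fun s _ => hderiv s) hpos hlim,
    ofReal_integral_eq_lintegral_ofReal]
  · exact integrableOn_Ioi_deriv_of_nonneg hc (fun s _ => hderiv s) hpos hlim
  · filter_upwards [ae_restrict_mem measurableSet_Ioi] with s hs using hpos s hs

theorem lintegral_hellingerMixing_inv : (1 : ℝ≥0∞) = ∫⁻ l, (ENNReal.ofReal l)⁻¹ ∂hellingerMixing := by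
  rw [lintegral_hellingerMixing (by fun_prop)]
  have h1 : ∀ s ∈ Set.Ioi (0 : ℝ), ENNReal.ofReal (4 / Real.pi * (s ^ 2 / (1 + s ^ 2) ^ 3))
      * (ENNReal.ofReal (s ^ 2 / (1 + s ^ 2)))⁻¹
      = ENNReal.ofReal (2 / Real.pi * ((1 - s ^ 2) / (1 + s ^ 2) ^ 2 + 1 / (1 + s ^ 2))) := by
    intro s hs
    have hs0 : 0 < s := hs
    have hpi := Real.pi_pos
    rw [← ENNReal.ofReal_inv_of_pos (by positivity), ← ENNReal.ofReal_mul (by positivity)]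
    congr 1
    field_simp
    ring
  have hlim := ((tendsto_div_one_add_sq.add
    (tendsto_nhds_of_tendsto_nhdsWithin Real.tendsto_arctan_atTop)).const_mul (2 / Real.pi))
  rw [setLIntegral_congr_fun measurableSet_Ioi h1, setLIntegral_Ioi_of_hasDerivAt
    (fun s => ((hasDerivAt_div_one_add_sq s).add (Real.hasDerivAt_arctan s)).const_mul _) _ hlim]
  · simp
  · intro s hs
    have hpi := Real.pi_pos
    have : (1 - s ^ 2) / (1 + s ^ 2) ^ 2 + 1 / (1 + s ^ 2) = 2 / (1 + s ^ 2) ^ 2 := by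
      field_simp; ring
    rw [this]
    positivity

/-- In the variable l the mixing density is (2/π) √(l (1 - l)); setting l = s² / (1 + s²) makes the
integrand rational in s, with an arctangent primitive. -/
theorem lintegral_hellingerMixing_leCamFun (t : ℝ) (ht : 0 ≤ t) :
    ENNReal.ofReal (fHellinger t) = ∫⁻ l, ENNReal.ofReal (leCamFun l t) ∂hellingerMixing := by
  by_cases ht1 : t = 1
  · simp [ht1, fHellinger, leCamFun]
  have hm : Measurable fun l => leCamFun l t :=
    measurable_leCamFun_uncurry.comp measurable_prodMk_right
  have hpi := Real.pi_pos
  obtain ⟨a, ha, rfl⟩ : ∃ a : ℝ, 0 ≤ a ∧ t = a ^ 2 :=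
    ⟨Real.sqrt t, Real.sqrt_nonneg t, (Real.sq_sqrt ht).symm⟩
  have hb : a ^ 2 - 1 ≠ 0 := sub_ne_zero.2 ht1
  rw [lintegral_hellingerMixing hm.ennreal_ofReal]
  -- With t = a², partial fractions in s² split the integrand into multiples of (1 + s²)⁻² and (1 +
  -- a² s²)⁻¹, each integrated explicitly. The limit at infinity is 2 + (a² - 1) - 2a = (1 - a)².
  set G : ℝ → ℝ := fun s => 4 / Real.pi * (Real.arctan s
    + (a ^ 2 - 1) / 2 * (s / (1 + s ^ 2) + Real.arctan s) - a * Real.arctan (a * s)) with hG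
  set G' : ℝ → ℝ := fun s => 4 / Real.pi * (1 / (1 + s ^ 2)
    + (a ^ 2 - 1) / 2 * ((1 - s ^ 2) / (1 + s ^ 2) ^ 2 + 1 / (1 + s ^ 2))
    - a * (1 / (1 + (a * s) ^ 2) * a)) with hG'
  have hGd : ∀ s, HasDerivAt G (G' s) s := by
    intro s
    have h1 : HasDerivAt (fun s : ℝ => a * s) a s := by
      simpa using (hasDerivAt_id s).const_mul a
    exact ((((Real.hasDerivAt_arctan s).add (((hasDerivAt_div_one_add_sq s).add
      (Real.hasDerivAt_arctan s)).const_mul _)).sub (h1.arctan.const_mul a)).const_mul _)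
  have heq : ∀ s, 4 / Real.pi * (s ^ 2 / (1 + s ^ 2) ^ 3)
      * leCamFun (s ^ 2 / (1 + s ^ 2)) (a ^ 2) = G' s := by
    intro s
    have h1 : 1 + (a * s) ^ 2 ≠ 0 := by positivity
    have h2 : 1 - s ^ 2 / (1 + s ^ 2) + s ^ 2 / (1 + s ^ 2) * a ^ 2
        = (1 + (a * s) ^ 2) / (1 + s ^ 2) := by field_simp; ring
    rw [leCamFun, h2, hG']
    field_simp
    ring
  have h1 : ∀ s ∈ Set.Ioi (0 : ℝ), ENNReal.ofReal (4 / Real.pi * (s ^ 2 / (1 + s ^ 2) ^ 3))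
      * ENNReal.ofReal (leCamFun (s ^ 2 / (1 + s ^ 2)) (a ^ 2)) = ENNReal.ofReal (G' s) := by
    intro s hs
    rw [← ENNReal.ofReal_mul (by positivity), heq]
  have hlim : Filter.Tendsto G Filter.atTop (nhds (fHellinger (a ^ 2))) := by
    have hat := tendsto_nhds_of_tendsto_nhdsWithin Real.tendsto_arctan_atTop
    have hat2 : Filter.Tendsto (fun s => a * Real.arctan (a * s)) Filter.atTop
        (nhds (a * (Real.pi / 2))) := by
      rcases ha.eq_or_lt with h | h
      · simp [← h]
      · exact (hat.comp (Filter.tendsto_id.const_mul_atTop h)).const_mul a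
    have := ((hat.add ((tendsto_div_one_add_sq.add hat).const_mul ((a ^ 2 - 1) / 2))).sub
      hat2).const_mul (4 / Real.pi)
    convert this using 2
    rw [fHellinger, Real.sqrt_sq ha]
    field_simp
    ring
  rw [setLIntegral_congr_fun measurableSet_Ioi h1, setLIntegral_Ioi_of_hasDerivAt hGd _ hlim]
  · simp [hG]
  · intro s _
    rw [← heq]
    have hl : s ^ 2 / (1 + s ^ 2) ∈ Set.Icc (0 : ℝ) 1 :=
      ⟨by positivity, (div_le_one (by positivity)).2 (by linarith)⟩
    exact mul_nonneg (by positivity) (leCamFun_nonneg hl ht)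

theorem fDiv_fHellinger {X : Type*} [MeasurableSpace X] (P Q : Measure X)
    [IsProbabilityMeasure P] [IsProbabilityMeasure Q] :
    fDiv fHellinger P Q = ∫⁻ l, leCamDiv l P Q ∂hellingerMixing :=
  fDiv_eq_lintegral_leCamDiv (g := fHellinger) (a := 0) (by unfold fHellinger; fun_prop)
    (fun _ _ => sq_nonneg _) (fun t _ => by simp) slopeAtTop_fHellinger (Or.inr rfl)
    lintegral_hellingerMixing_leCamFun lintegral_hellingerMixing_inv P Q

theorem klMixing_ne_zero : klMixing ≠ 0 := by
  intro h
  have := lintegral_klMixing_inv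
  simp [h] at this

theorem hellingerMixing_ne_zero : hellingerMixing ≠ 0 := by
  intro h
  have := lintegral_hellingerMixing_inv
  simp [h] at this

/-! ### Variance contraction under the privacy constraint -/

/-- The two-point variance inequality: `s`, `-t` are the means and `A`, `B` the second moments of a
function under two distributions whose likelihood ratio lies in `[E⁻¹, E]`. -/
theorem two_point_variance_le {E s t A B : ℝ} (hE : 1 ≤ E) (hs : 0 ≤ s) (ht : 0 ≤ t)
    (h1 : ∀ c, B + 2 * t * c + c ^ 2 ≤ E * (A - 2 * s * c + c ^ 2))
    (h2 : ∀ c, A - 2 * s * c + c ^ 2 ≤ E * (B + 2 * t * c + c ^ 2)) :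
    t * s ^ 2 + s * t ^ 2 ≤ ((E - 1) / (E + 1)) ^ 2 * (t * A + s * B) := by
  rcases hE.eq_or_lt with rfl | hE
  -- For E = 1 the quadratic terms in c cancel, leaving an affine inequality valid for all c; a
  -- large c forces its slope to vanish.
  · have hst : s + t = 0 := by
      by_contra hne
      have hpos : 0 < s + t := lt_of_le_of_ne (by positivity) (Ne.symm hne)
      have h := h1 ((|A - B| + 1) / (2 * (s + t)))
      have e : 2 * (s + t) * ((|A - B| + 1) / (2 * (s + t))) = |A - B| + 1 := by field_simp
      have := le_abs_self (A - B)
      linarith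
    have hs0 : s = 0 := by linarith
    have ht0 : t = 0 := by linarith
    simp [hs0, ht0]
  have hE1 : 0 < E - 1 := by linarith
  -- The chosen c minimizes the quadratic (E - 1) c² - 2 (E s + t) c + E A - B, so this is its
  -- discriminant condition; `k2` treats the other quadratic likewise.
  have k1 : (E * s + t) ^ 2 ≤ (E - 1) * (E * A - B) := by
    have h := h1 ((E * s + t) / (E - 1))
    have e : (E - 1) * ((E * s + t) / (E - 1)) = E * s + t := by field_simp
    generalize (E * s + t) / (E - 1) = c at h e
    have e' : (E - 1) * c * c = (E * s + t) * c := by rw [e]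
    rw [← e, mul_pow, sq (E - 1), mul_assoc]
    exact mul_le_mul_of_nonneg_left (by linarith) hE1.le
  have k2 : (E * t + s) ^ 2 ≤ (E - 1) * (E * B - A) := by
    have h := h2 (-((E * t + s) / (E - 1)))
    have e : (E - 1) * ((E * t + s) / (E - 1)) = E * t + s := by field_simp
    generalize (E * t + s) / (E - 1) = c at h e
    have e' : (E - 1) * c * c = (E * t + s) * c := by rw [e]
    rw [← e, mul_pow, sq (E - 1), mul_assoc]
    exact mul_le_mul_of_nonneg_left (by linarith) hE1.le
  -- The weights t E + s and t + s E are chosen so that the combination of `k1` and `k2` is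
  -- proportional to t A + s B.
  have k3 : (E * t + s) * (E * s + t) * (s + t) ≤ (E - 1) ^ 2 * (t * A + s * B) := by
    have a1 := mul_le_mul_of_nonneg_left k1 (by positivity : 0 ≤ t * E + s)
    have a2 := mul_le_mul_of_nonneg_left k2 (by positivity : 0 ≤ t + s * E)
    have e1 : (t * E + s) * ((E - 1) * (E * A - B)) + (t + s * E) * ((E - 1) * (E * B - A))
        = (E + 1) * ((E - 1) ^ 2 * (t * A + s * B)) := by ring
    have e2 : (t * E + s) * (E * s + t) ^ 2 + (t + s * E) * (E * t + s) ^ 2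
        = (E + 1) * ((E * t + s) * (E * s + t) * (s + t)) := by ring
    have : (E + 1) * ((E * t + s) * (E * s + t) * (s + t))
        ≤ (E + 1) * ((E - 1) ^ 2 * (t * A + s * B)) := by linarith
    exact le_of_mul_le_mul_left this (by linarith)
  have k4 : (t * s ^ 2 + s * t ^ 2) * (E + 1) ^ 2 ≤ (E * t + s) * (E * s + t) * (s + t) := by
    have : (E * t + s) * (E * s + t) * (s + t) - (t * s ^ 2 + s * t ^ 2) * (E + 1) ^ 2
        = E * (t - s) ^ 2 * (s + t) := by ring
    have : 0 ≤ E * (t - s) ^ 2 * (s + t) := by positivity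
    linarith
  rw [div_pow, div_mul_eq_mul_div, le_div_iff₀ (by positivity)]
  linarith

section

variable {X Z : Type*} [MeasurableSpace X] [MeasurableSpace Z]

theorem integrable_of_abs_le (μ : Measure X) [IsFiniteMeasure μ] {f : X → ℝ} {C : ℝ}
    (hf : Measurable f) (hC : ∀ x, |f x| ≤ C) : Integrable f μ :=
  Integrable.of_bound hf.aestronglyMeasurable C (Filter.Eventually.of_forall hC)

theorem abs_integral_le (μ : Measure X) [IsProbabilityMeasure μ] {f : X → ℝ} {C : ℝ}
    (hC : ∀ x, |f x| ≤ C) : |∫ x, f x ∂μ| ≤ C := by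
  have := norm_integral_le_of_norm_le_const (μ := μ) (f := f) (Filter.Eventually.of_forall hC)
  simpa using this

theorem IsLDP.le_smul {ε : ℝ} {K : Kernel X Z} (hK : IsLDP ε K) (x x' : X) :
    K x ≤ ENNReal.ofReal (Real.exp ε) • K x' :=
  Measure.le_iff.2 fun A hA => hK A hA x x'

theorem IsLDP.integral_le {ε : ℝ} {K : Kernel X Z} [IsMarkovKernel K] (hK : IsLDP ε K) (x x' : X)
    {f : Z → ℝ} {C : ℝ} (hf : Measurable f) (hC : ∀ z, |f z| ≤ C) (h0 : ∀ z, 0 ≤ f z) :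
    ∫ z, f z ∂K x ≤ Real.exp ε * ∫ z, f z ∂K x' := by
  have hint : Integrable f (ENNReal.ofReal (Real.exp ε) • K x') :=
    (integrable_of_abs_le _ hf hC).smul_measure ENNReal.ofReal_ne_top
  have := integral_mono_measure (hK.le_smul x x') (Filter.Eventually.of_forall h0) hint
  rwa [integral_smul_measure, ENNReal.toReal_ofReal (Real.exp_pos ε).le, smul_eq_mul] at this

theorem integral_sub_const_sq (μ : Measure X) [IsProbabilityMeasure μ] {u : X → ℝ} {C : ℝ}
    (hu : Measurable u) (hC : ∀ x, |u x| ≤ C) (c : ℝ) :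
    ∫ x, (u x - c) ^ 2 ∂μ = ∫ x, u x ^ 2 ∂μ - 2 * (∫ x, u x ∂μ) * c + c ^ 2 := by
  have hi : Integrable u μ := integrable_of_abs_le μ hu hC
  have hi2 : Integrable (fun x => u x ^ 2) μ := integrable_of_abs_le (C := C ^ 2) μ (by fun_prop)
    fun x => by rw [abs_pow]; exact pow_le_pow_left₀ (abs_nonneg _) (hC x) 2
  have h2 : Integrable (fun x => 2 * c * u x) μ := hi.const_mul _
  have e : (fun x => (u x - c) ^ 2) = fun x => u x ^ 2 - 2 * c * u x + c ^ 2 := by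
    funext x; ring
  rw [e, integral_add (f := fun x => u x ^ 2 - 2 * c * u x) (hi2.sub h2) (integrable_const _),
    integral_sub hi2 h2, integral_const_mul]
  simp
  ring

/-- A differentially private channel contracts variances by `Upsilon ε`. -/
theorem IsLDP.integral_sq_le {ε : ℝ} (hε : 0 ≤ ε) {K : Kernel X Z} [IsMarkovKernel K]
    (hK : IsLDP ε K) (Q : Measure X) [IsProbabilityMeasure Q] {u : Z → ℝ} {C : ℝ}
    (hu : Measurable u) (hC : ∀ z, |u z| ≤ C) (hmean : ∫ x, ∫ z, u z ∂K x ∂Q = 0) :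
    ∫ x, (∫ z, u z ∂K x) ^ 2 ∂Q ≤ Upsilon ε * ∫ x, ∫ z, u z ^ 2 ∂K x ∂Q := by
  have hE : 1 ≤ Real.exp ε := Real.one_le_exp hε
  have hΥ : 0 ≤ Upsilon ε := sq_nonneg _
  have hu2 : Measurable fun z => u z ^ 2 := by fun_prop
  have hC2 : ∀ z, |u z ^ 2| ≤ C ^ 2 := fun z => by
    rw [abs_pow]; exact pow_le_pow_left₀ (abs_nonneg _) (hC z) 2
  set φ : X → ℝ := fun x => ∫ z, u z ∂K x with hφ
  set S : X → ℝ := fun x => ∫ z, u z ^ 2 ∂K x with hS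
  have hφm : Measurable φ := hu.stronglyMeasurable.integral_kernel.measurable
  have hSm : Measurable S := hu2.stronglyMeasurable.integral_kernel.measurable
  have hφC : ∀ x, |φ x| ≤ C := fun x => abs_integral_le (K x) hC
  have hSC : ∀ x, |S x| ≤ C ^ 2 := fun x => abs_integral_le (K x) hC2
  have hS0 : ∀ x, 0 ≤ S x := fun x => integral_nonneg fun z => sq_nonneg _
  -- the quadratic inequalities coming from the likelihood ratio bound
  have hquad : ∀ x y c, S y - 2 * φ y * c + c ^ 2
      ≤ Real.exp ε * (S x - 2 * φ x * c + c ^ 2) := by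
    intro x y c
    rw [← integral_sub_const_sq (K y) hu hC, ← integral_sub_const_sq (K x) hu hC]
    refine hK.integral_le y x (C := (C + |c|) ^ 2) (by fun_prop) (fun z => ?_)
      fun z => sq_nonneg _
    rw [abs_pow]
    exact pow_le_pow_left₀ (abs_nonneg _) ((abs_sub _ _).trans (by linarith [hC z])) 2
  have hpair : ∀ x y, 0 < φ x → φ y < 0 → -φ y * φ x ^ 2 + φ x * (-φ y) ^ 2
      ≤ Upsilon ε * (-φ y * S x + φ x * S y) := by
    intro x y hx hy
    refine two_point_variance_le hE hx.le (by linarith) (fun c => ?_) fun c => ?_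
    · have := hquad x y c
      linarith
    · have := hquad y x c
      linarith
  -- positive and negative parts
  set p : X → ℝ := fun x => max (φ x) 0 with hp
  set n : X → ℝ := fun x => max (-φ x) 0 with hn
  set Sp : X → ℝ := fun x => {x | 0 < φ x}.indicator S x with hSp
  set Sn : X → ℝ := fun x => {x | φ x < 0}.indicator S x with hSn
  have hpm : Measurable p := by fun_prop
  have hnm : Measurable n := by fun_prop
  have hSpm : Measurable Sp := hSm.indicator (measurableSet_lt measurable_const hφm)
  have hSnm : Measurable Sn := hSm.indicator (measurableSet_lt hφm measurable_const)
  have hp0 : ∀ x, 0 ≤ p x := fun x => le_max_right _ _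
  have hn0 : ∀ x, 0 ≤ n x := fun x => le_max_right _ _
  have hSp0 : ∀ x, 0 ≤ Sp x := fun x => Set.indicator_nonneg (fun x _ => hS0 x) x
  have hSn0 : ∀ x, 0 ≤ Sn x := fun x => Set.indicator_nonneg (fun x _ => hS0 x) x
  have hpi : Integrable p Q := integrable_of_abs_le (C := C) Q hpm fun x => by
    rw [abs_of_nonneg (hp0 x)]
    exact max_le ((le_abs_self _).trans (hφC x)) ((abs_nonneg _).trans (hφC x))
  have hni : Integrable n Q := integrable_of_abs_le (C := C) Q hnm fun x => by
    rw [abs_of_nonneg (hn0 x)]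
    exact max_le ((neg_le_abs _).trans (hφC x)) ((abs_nonneg _).trans (hφC x))
  have hp2i : Integrable (fun x => p x ^ 2) Q :=
    integrable_of_abs_le (C := C ^ 2) Q (by fun_prop) fun x => by
      rw [abs_pow, abs_of_nonneg (hp0 x)]
      exact pow_le_pow_left₀ (hp0 x)
        (max_le ((le_abs_self _).trans (hφC x)) ((abs_nonneg _).trans (hφC x))) 2
  have hn2i : Integrable (fun x => n x ^ 2) Q :=
    integrable_of_abs_le (C := C ^ 2) Q (by fun_prop) fun x => by
      rw [abs_pow, abs_of_nonneg (hn0 x)]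
      exact pow_le_pow_left₀ (hn0 x)
        (max_le ((neg_le_abs _).trans (hφC x)) ((abs_nonneg _).trans (hφC x))) 2
  have hSi : Integrable S Q := integrable_of_abs_le Q hSm hSC
  have hSpi : Integrable Sp Q := hSi.indicator (measurableSet_lt measurable_const hφm)
  have hSni : Integrable Sn Q := hSi.indicator (measurableSet_lt hφm measurable_const)
  have hpn : ∀ x, φ x = p x - n x := fun x => by
    rcases le_total (φ x) 0 with h | h <;> simp [hp, hn, h]
  have hsq : ∀ x, φ x ^ 2 = p x ^ 2 + n x ^ 2 := fun x => by
    rcases le_total (φ x) 0 with h | h <;> simp [hp, hn, h]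
  -- Weighting by the negative part at y and the positive part at x extends the pair inequality to
  -- all x, y: for any other sign pattern the left side is 0.
  have hptw : ∀ x y, n y * p x ^ 2 + p x * n y ^ 2
      ≤ Upsilon ε * (n y * Sp x + p x * Sn y) := by
    intro x y
    by_cases hx : 0 < φ x
    · by_cases hy : φ y < 0
      · have := hpair x y hx hy
        simpa [hp, hn, hSp, hSn, hx, hy, hx.le, hy.le] using this
      · have : n y = 0 := max_eq_right (by linarith)
        rw [this]
        have := mul_nonneg hΥ (mul_nonneg (hp0 x) (hSn0 y))
        linarith
    · have : p x = 0 := max_eq_right (by linarith)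
      rw [this]
      have := mul_nonneg hΥ (mul_nonneg (hn0 y) (hSp0 x))
      linarith
  set a := ∫ x, p x ∂Q with ha
  have ha0 : 0 ≤ a := integral_nonneg hp0
  -- Mean zero equates the masses of the two parts. Integrating `hptw` over both variables therefore
  -- produces a common factor a.
  have han : ∫ x, n x ∂Q = a := by
    have h : ∫ x, φ x ∂Q = a - ∫ x, n x ∂Q := by
      rw [ha, ← integral_sub hpi hni]
      exact integral_congr_ae (Filter.Eventually.of_forall hpn)
    linarith
  have hint1 : ∀ y, n y * ∫ x, p x ^ 2 ∂Q + a * n y ^ 2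
      ≤ Upsilon ε * (n y * ∫ x, Sp x ∂Q + a * Sn y) := by
    intro y
    have := integral_mono (μ := Q) ((hp2i.const_mul (n y)).add (hpi.mul_const (n y ^ 2)))
      (((hSpi.const_mul (n y)).add (hpi.mul_const (Sn y))).const_mul (Upsilon ε))
      fun x => hptw x y
    simp only [Pi.add_apply] at this
    rwa [integral_add (hp2i.const_mul (n y)) (hpi.mul_const (n y ^ 2)), integral_const_mul,
      integral_mul_const, integral_const_mul,
      integral_add (hSpi.const_mul (n y)) (hpi.mul_const (Sn y)), integral_const_mul,
      integral_mul_const] at this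
  have hint2 : a * (∫ x, p x ^ 2 ∂Q + ∫ x, n x ^ 2 ∂Q)
      ≤ a * (Upsilon ε * (∫ x, Sp x ∂Q + ∫ x, Sn x ∂Q)) := by
    have := integral_mono (μ := Q)
      ((hni.mul_const (∫ x, p x ^ 2 ∂Q)).add (hn2i.const_mul a))
      (((hni.mul_const (∫ x, Sp x ∂Q)).add (hSni.const_mul a)).const_mul (Upsilon ε)) hint1
    simp only [Pi.add_apply] at this
    rw [integral_add (hni.mul_const (∫ x, p x ^ 2 ∂Q)) (hn2i.const_mul a), integral_mul_const,
      integral_const_mul, integral_const_mul,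
      integral_add (hni.mul_const (∫ x, Sp x ∂Q)) (hSni.const_mul a), integral_mul_const,
      integral_const_mul, han] at this
    linarith
  have hφ2 : ∫ x, φ x ^ 2 ∂Q = ∫ x, p x ^ 2 ∂Q + ∫ x, n x ^ 2 ∂Q := by
    rw [← integral_add hp2i hn2i]
    exact integral_congr_ae (Filter.Eventually.of_forall hsq)
  have hSle : ∫ x, Sp x ∂Q + ∫ x, Sn x ∂Q ≤ ∫ x, S x ∂Q := by
    rw [← integral_add hSpi hSni]
    refine integral_mono (hSpi.add hSni) hSi fun x => ?_
    rcases lt_trichotomy (φ x) 0 with h | h | h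
    · simp [hSp, hSn, h, h.le]
    · simp [hSp, hSn, h, hS0 x]
    · simp [hSp, hSn, h, h.le]
  -- If a = 0 it cannot be cancelled, but then both parts, hence φ, vanish almost everywhere.
  rcases ha0.eq_or_lt with h0 | hpos
  · have hz : ∀ f : X → ℝ, (∀ x, 0 ≤ f x) → Integrable f Q → ∫ x, f x ∂Q = 0 →
        ∫ x, f x ^ 2 ∂Q = 0 := by
      intro f hf hfi hf0
      refine integral_eq_zero_of_ae ?_
      filter_upwards [(integral_eq_zero_iff_of_nonneg hf hfi).1 hf0] with x hx
      simp [hx]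
    rw [hφ2, hz p hp0 hpi h0.symm, hz n hn0 hni (han.trans h0.symm), add_zero]
    exact mul_nonneg hΥ (integral_nonneg hS0)
  · rw [hφ2]
    exact (le_of_mul_le_mul_left hint2 hpos).trans (mul_le_mul_of_nonneg_left hSle hΥ)

/-! ### The χ² bound -/

theorem integral_comp_measure (K : Kernel X Z) (μ : Measure X) {f : Z → ℝ}
    (hf : Integrable f (K ∘ₘ μ)) : ∫ z, f z ∂(K ∘ₘ μ) = ∫ x, ∫ z, f z ∂K x ∂μ := by
  rw [Measure.comp_eq_comp_const_apply] at hf ⊢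
  rw [Kernel.integral_comp hf, Kernel.const_apply]

/-- The output density of a differentially private channel is bounded. -/
theorem IsLDP.rnDeriv_le {ε : ℝ} {K : Kernel X Z} [IsMarkovKernel K] (hK : IsLDP ε K)
    (P Q : Measure X) [IsProbabilityMeasure P] [IsProbabilityMeasure Q] :
    ∀ᵐ z ∂(K ∘ₘ Q), ((K ∘ₘ P).rnDeriv (K ∘ₘ Q) z).toReal ≤ Real.exp ε := by
  have hle : ∀ A, MeasurableSet A → (K ∘ₘ P) A ≤ ENNReal.ofReal (Real.exp ε) * (K ∘ₘ Q) A := by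
    intro A hA
    -- Averaging over the first input alone gives a bound for every x', which is then averaged over
    -- Q.
    have h1 : ∀ x', (K ∘ₘ P) A ≤ ENNReal.ofReal (Real.exp ε) * K x' A := by
      intro x'
      rw [Measure.bind_apply hA K.aemeasurable]
      calc ∫⁻ x, K x A ∂P ≤ ∫⁻ _, ENNReal.ofReal (Real.exp ε) * K x' A ∂P :=
            lintegral_mono fun x => hK A hA x x'
        _ = _ := by simp
    rw [Measure.bind_apply hA K.aemeasurable (m := Q), ← lintegral_const_mul' _ _
      ENNReal.ofReal_ne_top]
    calc (K ∘ₘ P) A = ∫⁻ _, (K ∘ₘ P) A ∂Q := by simp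
      _ ≤ _ := lintegral_mono h1
  have hae : (K ∘ₘ P).rnDeriv (K ∘ₘ Q) ≤ᵐ[K ∘ₘ Q] fun _ => ENNReal.ofReal (Real.exp ε) := by
    refine ae_le_of_forall_setLIntegral_le_of_sigmaFinite (Measure.measurable_rnDeriv _ _)
      fun A hA _ => ?_
    rw [setLIntegral_const]
    exact (Measure.setLIntegral_rnDeriv_le A).trans (hle A hA)
  filter_upwards [hae] with z hz
  exact ENNReal.toReal_le_of_le_ofReal (Real.exp_pos ε).le hz

theorem absolutelyContinuous_of_leCamDiv_zero_ne_top {P Q : Measure X} [IsProbabilityMeasure P]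
    [IsProbabilityMeasure Q] (h : leCamDiv 0 P Q ≠ ⊤) : P ≪ Q := by
  rw [← Measure.singularPart_eq_zero, ← Measure.measure_univ_eq_zero]
  by_contra hne
  exact h (by simp [leCamDiv, ENNReal.top_mul hne])

theorem leCamDiv_of_ac {P Q : Measure X} [IsProbabilityMeasure P]
    [IsProbabilityMeasure Q] (h : P ≪ Q) (l : ℝ) :
    leCamDiv l P Q = ∫⁻ x, ENNReal.ofReal (leCamFun l (P.rnDeriv Q x).toReal) ∂Q := by
  simp [leCamDiv, (Measure.singularPart_eq_zero P Q).2 h]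

theorem leCamDiv_zero_of_ac {P Q : Measure X} [IsProbabilityMeasure P]
    [IsProbabilityMeasure Q] (h : P ≪ Q) :
    leCamDiv 0 P Q = ∫⁻ x, ENNReal.ofReal (((P.rnDeriv Q x).toReal - 1) ^ 2) ∂Q := by
  simp [leCamDiv_of_ac h, leCamFun]

/-- A differentially private channel contracts the `χ²`-divergence by `Upsilon ε`. -/
theorem IsLDP.leCamDiv_zero_le {ε : ℝ} (hε : 0 ≤ ε) {K : Kernel X Z} [IsMarkovKernel K]
    (hK : IsLDP ε K) (P Q : Measure X) [IsProbabilityMeasure P] [IsProbabilityMeasure Q]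
    (hfin : leCamDiv 0 P Q ≠ ⊤) :
    leCamDiv 0 (K ∘ₘ P) (K ∘ₘ Q) ≤ ENNReal.ofReal (Upsilon ε) * leCamDiv 0 P Q := by
  have hac := absolutelyContinuous_of_leCamDiv_zero_ne_top hfin
  have hacK : K ∘ₘ P ≪ K ∘ₘ Q := hac.comp_right K
  have hE : 1 ≤ Real.exp ε := Real.one_le_exp hε
  have hΥ : 0 ≤ Upsilon ε := sq_nonneg _
  set r : X → ℝ := fun x => (P.rnDeriv Q x).toReal with hr
  set R : Z → ℝ := fun z => ((K ∘ₘ P).rnDeriv (K ∘ₘ Q) z).toReal with hR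
  have hrm : Measurable r := (Measure.measurable_rnDeriv _ _).ennreal_toReal
  have hRm : Measurable R := (Measure.measurable_rnDeriv _ _).ennreal_toReal
  rw [leCamDiv_zero_of_ac hac] at hfin ⊢
  rw [leCamDiv_zero_of_ac hacK]
  have hri : Integrable (fun x => (r x - 1) ^ 2) Q := by
    refine ⟨by fun_prop, ?_⟩
    rw [hasFiniteIntegral_iff_ofReal (Filter.Eventually.of_forall fun x => sq_nonneg _)]
    exact lt_top_iff_ne_top.2 hfin
  have hr1 : Integrable (fun x => r x - 1) Q :=
    Measure.integrable_toReal_rnDeriv.sub (integrable_const 1)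
  -- a bounded version of the centred output density
  set u : Z → ℝ := fun z => min (R z) (Real.exp ε) - 1 with hu
  have hum : Measurable u := by fun_prop
  have huC : ∀ z, |u z| ≤ Real.exp ε := fun z => by
    have h0 : 0 ≤ R z := ENNReal.toReal_nonneg
    have h1 : 0 ≤ min (R z) (Real.exp ε) := le_min h0 (Real.exp_pos ε).le
    have h2 : min (R z) (Real.exp ε) ≤ Real.exp ε := min_le_right _ _
    rw [abs_le]
    constructor <;> simp only [hu] <;> linarith
  have huR : ∀ᵐ z ∂(K ∘ₘ Q), u z = R z - 1 := by
    filter_upwards [hK.rnDeriv_le P Q] with z hz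
    simp only [hu]
    rw [min_eq_left hz]
  have hui : ∀ μ : Measure Z, [IsFiniteMeasure μ] → Integrable u μ :=
    fun μ _ => integrable_of_abs_le μ hum huC
  have hu2i : ∀ μ : Measure Z, [IsFiniteMeasure μ] → Integrable (fun z => u z ^ 2) μ :=
    fun μ _ => integrable_of_abs_le (C := Real.exp ε ^ 2) μ (by fun_prop) fun z => by
      rw [abs_pow]; exact pow_le_pow_left₀ (abs_nonneg _) (huC z) 2
  set φ : X → ℝ := fun x => ∫ z, u z ∂K x with hφ
  have hφm : Measurable φ := hum.stronglyMeasurable.integral_kernel.measurable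
  have hφC : ∀ x, |φ x| ≤ Real.exp ε := fun x => abs_integral_le (K x) huC
  have hφQ : ∫ x, φ x ∂Q = 0 := by
    rw [← integral_comp_measure K Q (hui _), integral_congr_ae huR,
      integral_sub Measure.integrable_toReal_rnDeriv (integrable_const 1),
      Measure.integral_toReal_rnDeriv hacK]
    simp
  have hvar := hK.integral_sq_le hε Q hum huC hφQ
  rw [← integral_comp_measure K Q (hu2i _)] at hvar
  set V := ∫ z, u z ^ 2 ∂(K ∘ₘ Q) with hV
  set D := ∫ x, (r x - 1) ^ 2 ∂Q with hD
  -- Since u = R - 1 almost everywhere, V is the difference of the integrals of u under the two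
  -- outputs; pulled back through K, it is the difference of the integrals of φ under P and Q.
  have hV1 : V = ∫ x, φ x * (r x - 1) ∂Q := by
    have e1 : V = ∫ z, (R z * u z - u z) ∂(K ∘ₘ Q) := by
      refine integral_congr_ae ?_
      filter_upwards [huR] with z hz
      rw [hz]; ring
    have hRu : Integrable (fun z => R z * u z) (K ∘ₘ Q) :=
      Measure.integrable_toReal_rnDeriv.mul_bdd (c := Real.exp ε) hum.aestronglyMeasurable
        (Filter.Eventually.of_forall huC)
    have hrφ : Integrable (fun x => r x * φ x) Q :=
      Measure.integrable_toReal_rnDeriv.mul_bdd (c := Real.exp ε) hφm.aestronglyMeasurable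
        (Filter.Eventually.of_forall hφC)
    have e2 : ∫ z, R z * u z ∂(K ∘ₘ Q) = ∫ z, u z ∂(K ∘ₘ P) := integral_rnDeriv_smul hacK
    have e3 : ∫ x, r x * φ x ∂Q = ∫ x, φ x ∂P := integral_rnDeriv_smul hac
    rw [e1, integral_sub hRu (hui _), e2, integral_comp_measure K P (hui _),
      integral_comp_measure K Q (hui _), ← e3, ← integral_sub hrφ (integrable_of_abs_le Q hφm hφC)]
    exact integral_congr_ae (Filter.Eventually.of_forall fun x => by ring)
  have hV0 : 0 ≤ V := integral_nonneg fun z => sq_nonneg _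
  have hφ2i : Integrable (fun x => φ x ^ 2) Q :=
    integrable_of_abs_le (C := Real.exp ε ^ 2) Q (by fun_prop) fun z => by
      rw [abs_pow]; exact pow_le_pow_left₀ (abs_nonneg _) (hφC z) 2
  have hφri : Integrable (fun x => φ x * (r x - 1)) Q :=
    hr1.bdd_mul (c := Real.exp ε) hφm.aestronglyMeasurable (Filter.Eventually.of_forall hφC)
  have hD0 : 0 ≤ D := integral_nonneg fun z => sq_nonneg _
  -- Cauchy–Schwarz in the form θ φ (r - 1) ≤ φ²/2 + θ² (r - 1)²/2. A positive θ is used because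
  -- `Upsilon ε` is 0 at ε = 0; letting θ decrease to it recovers the bound.
  have hmain : ∀ θ, 0 < θ → Upsilon ε ≤ θ → V ≤ θ * D := by
    intro θ hθ hΥθ
    have h1 : θ * V ≤ ∫ x, (φ x ^ 2 / 2 + θ ^ 2 / 2 * (r x - 1) ^ 2) ∂Q := by
      rw [hV1, ← integral_const_mul]
      refine integral_mono (hφri.const_mul θ) ((hφ2i.div_const 2).add (hri.const_mul _))
        fun x => ?_
      nlinarith [sq_nonneg (φ x - θ * (r x - 1))]
    rw [integral_add (hφ2i.div_const 2) (hri.const_mul _), integral_div, integral_const_mul] at h1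
    have h2 : Upsilon ε * V ≤ θ * V := mul_le_mul_of_nonneg_right hΥθ hV0
    have h3 : θ * V ≤ θ * (θ * D) := by nlinarith
    exact le_of_mul_le_mul_left h3 hθ
  have hfinal : V ≤ Upsilon ε * D := by
    have hlim : Filter.Tendsto (fun θ : ℝ => θ * D) (nhdsWithin (Upsilon ε) (Set.Ioi (Upsilon ε)))
        (nhds (Upsilon ε * D)) :=
      ((continuous_id.mul continuous_const).tendsto _).mono_left nhdsWithin_le_nhds
    refine ge_of_tendsto hlim ?_
    filter_upwards [self_mem_nhdsWithin] with θ hθ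
    exact hmain θ (lt_of_le_of_lt hΥ hθ) (le_of_lt hθ)
  have e1 : ∫⁻ z, ENNReal.ofReal ((R z - 1) ^ 2) ∂(K ∘ₘ Q) = ENNReal.ofReal V := by
    rw [hV, ofReal_integral_eq_lintegral_ofReal (hu2i _)
      (Filter.Eventually.of_forall fun z => sq_nonneg _)]
    refine lintegral_congr_ae ?_
    filter_upwards [huR] with z hz
    rw [hz]
  rw [e1, ← ofReal_integral_eq_lintegral_ofReal hri
    (Filter.Eventually.of_forall fun z => sq_nonneg _), ← ENNReal.ofReal_mul hΥ]
  exact ENNReal.ofReal_le_ofReal hfinal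

theorem IsLDP.contractionCoeff_fChiSq_le {ε : ℝ} (hε : 0 ≤ ε) {K : Kernel X Z} [IsMarkovKernel K]
    (hK : IsLDP ε K) : contractionCoeff fChiSq K ≤ ENNReal.ofReal (Upsilon ε) := by
  refine iSup_le fun P => iSup_le fun Q => iSup_le fun _ => iSup_le fun _ => iSup_le fun _ => ?_
  rw [fDiv_fChiSq, fDiv_fChiSq]
  by_cases h : leCamDiv 0 P Q = ⊤
  · simp [h]
  · exact ENNReal.div_le_of_le_mul (hK.leCamDiv_zero_le hε P Q h)

/-! ### Comparing contraction coefficients with that of χ² -/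

theorem fDiv_comp_le_contractionCoeff_mul {f : ℝ → ℝ} (K : Kernel X Z) {P Q : Measure X}
    [IsProbabilityMeasure P] [IsProbabilityMeasure Q] (hne : P ≠ Q) (h0 : fDiv f P Q ≠ 0)
    (htop : fDiv f P Q ≠ ⊤) :
    fDiv f (K ∘ₘ P) (K ∘ₘ Q) ≤ contractionCoeff f K * fDiv f P Q := by
  rw [← ENNReal.div_le_iff h0 htop]
  exact le_iSup_of_le P (le_iSup_of_le Q (le_iSup_of_le inferInstance
    (le_iSup_of_le inferInstance (le_iSup_of_le hne le_rfl))))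

/-- Apply the χ² contraction to P and the mixture l P + (1 - l) Q. The kernel sends this mixture to
the mixture of the outputs, so the factor (1 - l)² appears on both sides and cancels. -/
theorem leCamDiv_comp_le {K : Kernel X Z} [IsMarkovKernel K] {l : ℝ}
    (hl : l ∈ Set.Ioo (0 : ℝ) 1) {P Q : Measure X} [IsProbabilityMeasure P]
    [IsProbabilityMeasure Q] (hne : P ≠ Q) :
    leCamDiv l (K ∘ₘ P) (K ∘ₘ Q) ≤ contractionCoeff fChiSq K * leCamDiv l P Q := by
  have := isProbabilityMeasure_mix ⟨hl.1.le, hl.2.le⟩ P Q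
  have hne' : P ≠ mix l P Q := fun h => hne (eq_of_mix_eq hl (Or.inl h.symm))
  have hc0 : ENNReal.ofReal ((1 - l) ^ 2) ≠ 0 := by
    have : 0 < 1 - l := by linarith [hl.2]
    simpa using this.ne'
  have hD : fDiv fChiSq P (mix l P Q) = ENNReal.ofReal ((1 - l) ^ 2) * leCamDiv l P Q := by
    rw [fDiv_fChiSq, leCamDiv_zero_mix hl]
  have h0 : fDiv fChiSq P (mix l P Q) ≠ 0 := by
    rw [hD]
    exact mul_ne_zero hc0 fun h => hne (eq_of_leCamDiv_eq_zero ⟨hl.1.le, hl.2⟩ h)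
  have htop : fDiv fChiSq P (mix l P Q) ≠ ⊤ := by
    rw [hD]; exact ENNReal.mul_ne_top ENNReal.ofReal_ne_top (leCamDiv_ne_top hl P Q)
  have h := fDiv_comp_le_contractionCoeff_mul K hne' h0 htop
  have hmK := comp_mix l P Q K
  have : IsProbabilityMeasure (K ∘ₘ mix l P Q) := inferInstance
  rw [fDiv_fChiSq, hD, hmK, leCamDiv_zero_mix hl, mul_left_comm] at h
  exact (ENNReal.mul_le_mul_iff_right hc0 ENNReal.ofReal_ne_top).1 h

theorem contractionCoeff_le_fChiSq {f : ℝ → ℝ} {ν : Measure ℝ}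
    (hmem : ∀ᵐ l ∂ν, l ∈ Set.Ioo (0 : ℝ) 1)
    (hX : ∀ (P Q : Measure X) [IsProbabilityMeasure P] [IsProbabilityMeasure Q],
      fDiv f P Q = ∫⁻ l, leCamDiv l P Q ∂ν)
    (hZ : ∀ (P Q : Measure Z) [IsProbabilityMeasure P] [IsProbabilityMeasure Q],
      fDiv f P Q = ∫⁻ l, leCamDiv l P Q ∂ν)
    (K : Kernel X Z) [IsMarkovKernel K] : contractionCoeff f K ≤ contractionCoeff fChiSq K := by
  refine iSup_le fun P => iSup_le fun Q => iSup_le fun _ => iSup_le fun _ => iSup_le fun hne => ?_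
  refine ENNReal.div_le_of_le_mul ?_
  rw [hX, hZ, ← lintegral_const_mul _ (measurable_leCamDiv P Q)]
  refine lintegral_mono_ae ?_
  filter_upwards [hmem] with l hl using leCamDiv_comp_le hl hne

theorem mix_rnDeriv {P Q : Measure X} [IsProbabilityMeasure P] [IsProbabilityMeasure Q]
    (hac : P ≪ Q) {d : ℝ} (hd : d ∈ Set.Icc (0 : ℝ) 1) :
    mix d P Q ≪ Q ∧ ∀ᵐ x ∂Q, ((mix d P Q).rnDeriv Q x).toReal
      = 1 + d * ((P.rnDeriv Q x).toReal - 1) := by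
  have h1 : 0 ≤ 1 - d := by linarith [hd.2]
  have hm : Measurable fun x => ENNReal.ofReal d * P.rnDeriv Q x + ENNReal.ofReal (1 - d) := by
    fun_prop
  have he : mix d P Q
      = Q.withDensity fun x => ENNReal.ofReal d * P.rnDeriv Q x + ENNReal.ofReal (1 - d) := by
    refine Measure.ext fun A hA => ?_
    rw [withDensity_apply _ hA, lintegral_add_right _ measurable_const, setLIntegral_const,
      lintegral_const_mul _ (Measure.measurable_rnDeriv P Q), Measure.setLIntegral_rnDeriv hac]
    rfl
  refine ⟨he ▸ withDensity_absolutelyContinuous _ _, ?_⟩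
  have h := Measure.rnDeriv_withDensity Q hm
  rw [← he] at h
  filter_upwards [h, Measure.rnDeriv_ne_top P Q] with x hx hxt
  rw [hx, ENNReal.toReal_add (ENNReal.mul_ne_top ENNReal.ofReal_ne_top hxt) ENNReal.ofReal_ne_top,
    ENNReal.toReal_mul, ENNReal.toReal_ofReal hd.1, ENNReal.toReal_ofReal h1]
  ring

/-- The perturbed density is 1 + d (t - 1), so the numerator is d² (t - 1)², and the denominator is
at least 1 - d uniformly in l. -/
theorem leCamDiv_mix_le {P Q : Measure X} [IsProbabilityMeasure P] [IsProbabilityMeasure Q]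
    (hac : P ≪ Q) {d l : ℝ} (hd : d ∈ Set.Ioo (0 : ℝ) 1) (hl : l ∈ Set.Ioo (0 : ℝ) 1) :
    leCamDiv l (mix d P Q) Q ≤ ENNReal.ofReal (d ^ 2 / (1 - d)) * leCamDiv 0 P Q := by
  have hd' : d ∈ Set.Icc (0 : ℝ) 1 := ⟨hd.1.le, hd.2.le⟩
  have := isProbabilityMeasure_mix hd' P Q
  obtain ⟨hacm, hrn⟩ := mix_rnDeriv hac hd'
  have hd1 : 0 < 1 - d := by linarith [hd.2]
  rw [leCamDiv_of_ac hacm, leCamDiv_zero_of_ac hac, ← lintegral_const_mul' _ _ ENNReal.ofReal_ne_top]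
  refine lintegral_mono_ae ?_
  filter_upwards [hrn] with x hx
  rw [hx, ← ENNReal.ofReal_mul (by positivity)]
  refine ENNReal.ofReal_le_ofReal ?_
  have ht : 0 ≤ (P.rnDeriv Q x).toReal := ENNReal.toReal_nonneg
  generalize (P.rnDeriv Q x).toReal = t at ht
  have hden : 1 - d ≤ 1 - l + l * (1 + d * (t - 1)) := by
    have h1 : 0 ≤ l * d * t := by have := hl.1; have := hd.1; positivity
    have h2 : l * d ≤ 1 * d := mul_le_mul_of_nonneg_right hl.2.le hd.1.le
    linarith
  rw [leCamFun, div_mul_eq_mul_div,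
    show (1 + d * (t - 1) - 1) ^ 2 = d ^ 2 * (t - 1) ^ 2 by ring]
  exact div_le_div_of_nonneg_left (by positivity) hd1 hden

/-- Converse to `leCamDiv_mix_le`: a density bounded by E keeps the denominator below 1 + d E,
uniformly in l. -/
theorem le_leCamDiv_mix {P Q : Measure X} [IsProbabilityMeasure P] [IsProbabilityMeasure Q]
    (hac : P ≪ Q) {d l E : ℝ} (hE : 1 ≤ E) (hle : ∀ᵐ x ∂Q, (P.rnDeriv Q x).toReal ≤ E)
    (hd : d ∈ Set.Ioo (0 : ℝ) 1) (hl : l ∈ Set.Ioo (0 : ℝ) 1) :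
    ENNReal.ofReal (d ^ 2 / (1 + d * E)) * leCamDiv 0 P Q ≤ leCamDiv l (mix d P Q) Q := by
  have hd' : d ∈ Set.Icc (0 : ℝ) 1 := ⟨hd.1.le, hd.2.le⟩
  have := isProbabilityMeasure_mix hd' P Q
  obtain ⟨hacm, hrn⟩ := mix_rnDeriv hac hd'
  have hd0 := hd.1
  have hl0 := hl.1
  rw [leCamDiv_of_ac hacm, leCamDiv_zero_of_ac hac, ← lintegral_const_mul' _ _ ENNReal.ofReal_ne_top]
  refine lintegral_mono_ae ?_
  filter_upwards [hrn, hle] with x hx hxE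
  rw [hx, ← ENNReal.ofReal_mul (by positivity)]
  refine ENNReal.ofReal_le_ofReal ?_
  have ht : 0 ≤ (P.rnDeriv Q x).toReal := ENNReal.toReal_nonneg
  generalize (P.rnDeriv Q x).toReal = t at ht hxE
  have hpos : 0 < 1 - l + l * (1 + d * (t - 1)) := by
    have h1 : 0 ≤ l * d * t := by positivity
    have h2 : l * d < 1 := by nlinarith [hl.2, hd.2]
    linarith
  have hden : 1 - l + l * (1 + d * (t - 1)) ≤ 1 + d * E := by
    have h1 : l * d * t ≤ 1 * d * E := by
      have h3 := hl.2.le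
      gcongr
    have h2 : 0 ≤ l * d := by positivity
    linarith
  rw [leCamFun, div_mul_eq_mul_div,
    show (1 + d * (t - 1) - 1) ^ 2 = d ^ 2 * (t - 1) ^ 2 by ring]
  exact div_le_div_of_nonneg_left (by positivity) hpos hden

/-- The contraction of f at the perturbed pair is squeezed between the two uniform Le Cam estimates.
The factors d² and ν(ℝ) cancel, and the remaining loss (1 - d) / (1 + d E) tends to 1 as d → 0. -/
theorem IsLDP.fChiSq_le_contractionCoeff {ε : ℝ} (hε : 0 ≤ ε) {f : ℝ → ℝ} {ν : Measure ℝ}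
    (hν0 : ν ≠ 0) (hνtop : ν Set.univ ≠ ⊤) (hmem : ∀ᵐ l ∂ν, l ∈ Set.Ioo (0 : ℝ) 1)
    (hX : ∀ (P Q : Measure X) [IsProbabilityMeasure P] [IsProbabilityMeasure Q],
      fDiv f P Q = ∫⁻ l, leCamDiv l P Q ∂ν)
    (hZ : ∀ (P Q : Measure Z) [IsProbabilityMeasure P] [IsProbabilityMeasure Q],
      fDiv f P Q = ∫⁻ l, leCamDiv l P Q ∂ν)
    {K : Kernel X Z} [IsMarkovKernel K] (hK : IsLDP ε K) :
    contractionCoeff fChiSq K ≤ contractionCoeff f K := by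
  refine iSup_le fun P => iSup_le fun Q => iSup_le fun _ => iSup_le fun _ => iSup_le fun hne => ?_
  rw [fDiv_fChiSq, fDiv_fChiSq]
  by_cases hfin : leCamDiv 0 P Q = ⊤
  · simp [hfin]
  refine ENNReal.div_le_of_le_mul ?_
  have hac := absolutelyContinuous_of_leCamDiv_zero_ne_top hfin
  have hacK : K ∘ₘ P ≪ K ∘ₘ Q := hac.comp_right K
  have hE : 1 ≤ Real.exp ε := Real.one_le_exp hε
  set E := Real.exp ε
  have hc0 : ν Set.univ ≠ 0 := by simpa using hν0
  have hstep : ∀ d ∈ Set.Ioo (0 : ℝ) 1, ENNReal.ofReal ((1 - d) / (1 + d * E))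
      * leCamDiv 0 (K ∘ₘ P) (K ∘ₘ Q) ≤ contractionCoeff f K * leCamDiv 0 P Q := by
    intro d hd
    have hd0 := hd.1
    have hd1 : 0 < 1 - d := by linarith [hd.2]
    have := isProbabilityMeasure_mix ⟨hd.1.le, hd.2.le⟩ P Q
    have hmne : mix d P Q ≠ Q := fun h => hne (eq_of_mix_eq hd (Or.inr h))
    have hupper : fDiv f (mix d P Q) Q
        ≤ ν Set.univ * (ENNReal.ofReal (d ^ 2 / (1 - d)) * leCamDiv 0 P Q) := by
      rw [hX, mul_comm, ← lintegral_const]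
      refine lintegral_mono_ae ?_
      filter_upwards [hmem] with l hl using leCamDiv_mix_le hac hd hl
    have hlower : ν Set.univ * (ENNReal.ofReal (d ^ 2 / (1 + d * E))
        * leCamDiv 0 (K ∘ₘ P) (K ∘ₘ Q)) ≤ fDiv f (K ∘ₘ mix d P Q) (K ∘ₘ Q) := by
      rw [hZ, mul_comm, ← lintegral_const, comp_mix]
      refine lintegral_mono_ae ?_
      filter_upwards [hmem] with l hl using le_leCamDiv_mix hacK hE (hK.rnDeriv_le P Q) hd hl
    have htop : fDiv f (mix d P Q) Q ≠ ⊤ :=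
      ne_top_of_le_ne_top (ENNReal.mul_ne_top hνtop
        (ENNReal.mul_ne_top ENNReal.ofReal_ne_top hfin)) hupper
    have h0 : fDiv f (mix d P Q) Q ≠ 0 := by
      rw [hX]
      intro h
      rw [lintegral_eq_zero_iff (measurable_leCamDiv _ _)] at h
      have : (ae ν).NeBot := ae_neBot.2 hν0
      obtain ⟨l, hl, hl'⟩ := (h.and hmem).exists
      exact hmne (eq_of_leCamDiv_eq_zero ⟨hl'.1.le, hl'.2⟩ hl)
    have hmain := (hlower.trans (fDiv_comp_le_contractionCoeff_mul K hmne h0 htop)).trans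
      (mul_le_mul_right hupper _)
    rw [mul_left_comm (contractionCoeff f K)] at hmain
    have h1 := (ENNReal.mul_le_mul_iff_right hc0 hνtop).1 hmain
    -- The multiplier (1 - d) / d² is the inverse of the constant in the upper estimate.
    have h2 := mul_le_mul_right h1 (ENNReal.ofReal ((1 - d) / d ^ 2))
    rw [← mul_assoc, mul_left_comm, ← mul_assoc (ENNReal.ofReal ((1 - d) / d ^ 2)),
      ← ENNReal.ofReal_mul (by positivity), ← ENNReal.ofReal_mul (by positivity)] at h2
    have e1 : (1 - d) / d ^ 2 * (d ^ 2 / (1 + d * E)) = (1 - d) / (1 + d * E) := by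
      field_simp
    have e2 : (1 - d) / d ^ 2 * (d ^ 2 / (1 - d)) = 1 := by
      field_simp
    rwa [e1, e2, ENNReal.ofReal_one, one_mul] at h2
  have hcont : Filter.Tendsto (fun d : ℝ => (1 - d) / (1 + d * E)) (nhdsWithin 0 (Set.Ioi 0))
      (nhds 1) := by
    have : ContinuousAt (fun d : ℝ => (1 - d) / (1 + d * E)) 0 := by
      refine ContinuousAt.div (by fun_prop) (by fun_prop) (by simp)
    have h := this.tendsto
    simp only [sub_zero, zero_mul, add_zero, div_one] at h
    exact h.mono_left nhdsWithin_le_nhds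
  have hlim := ENNReal.Tendsto.mul_const (b := leCamDiv 0 (K ∘ₘ P) (K ∘ₘ Q))
    (ENNReal.tendsto_ofReal hcont) (Or.inl (by simp))
  rw [ENNReal.ofReal_one, one_mul] at hlim
  refine le_of_tendsto hlim ?_
  filter_upwards [Ioo_mem_nhdsGT (zero_lt_one' ℝ)] with d hd using hstep d hd

theorem IsLDP.contractionCoeff_fKL {ε : ℝ} (hε : 0 ≤ ε) {K : Kernel X Z} [IsMarkovKernel K]
    (hK : IsLDP ε K) : contractionCoeff fKL K = contractionCoeff fChiSq K :=
  le_antisymm (contractionCoeff_le_fChiSq klMixing_mem fDiv_fKL fDiv_fKL K)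
    (hK.fChiSq_le_contractionCoeff hε klMixing_ne_zero
      (measure_univ_ne_top_of_lintegral_leCamFun klMixing_mem lintegral_klMixing_leCamFun)
      klMixing_mem fDiv_fKL fDiv_fKL)

theorem IsLDP.contractionCoeff_fHellinger {ε : ℝ} (hε : 0 ≤ ε) {K : Kernel X Z}
    [IsMarkovKernel K] (hK : IsLDP ε K) :
    contractionCoeff fHellinger K = contractionCoeff fChiSq K :=
  le_antisymm (contractionCoeff_le_fChiSq hellingerMixing_mem fDiv_fHellinger fDiv_fHellinger K)
    (hK.fChiSq_le_contractionCoeff hε hellingerMixing_ne_zero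
      (measure_univ_ne_top_of_lintegral_leCamFun hellingerMixing_mem
        lintegral_hellingerMixing_leCamFun)
      hellingerMixing_mem fDiv_fHellinger fDiv_fHellinger)

end

/-! ### Binary randomized response -/

theorem bern_apply_true (p : unitInterval) : bern p {true} = ENNReal.ofReal p := by
  simp [bern, ENNReal.ofReal, Real.toNNReal_of_nonneg p.2.1]; rfl

theorem bern_apply_false (p : unitInterval) : bern p {false} = ENNReal.ofReal (1 - p) := by
  simp [bern, ENNReal.ofReal, Real.toNNReal_of_nonneg (sub_nonneg.2 p.2.2)]; rfl

instance (p : unitInterval) : IsProbabilityMeasure (bern p) := by unfold bern; infer_instance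

instance : IsProbabilityMeasure fairCoin := by unfold fairCoin; infer_instance

theorem measure_bool_ext {μ ν : Measure Bool} (h1 : μ {true} = ν {true})
    (h2 : μ {false} = ν {false}) : μ = ν :=
  Measure.ext_of_singleton fun b => by cases b <;> assumption

theorem lintegral_bern (p : unitInterval) (h : Bool → ℝ≥0∞) :
    ∫⁻ b, h b ∂(bern p)
      = h true * ENNReal.ofReal p + h false * ENNReal.ofReal (1 - p) := by
  rw [lintegral_fintype, Fintype.sum_bool, bern_apply_true, bern_apply_false]

theorem leCamDiv_bern_fairCoin (a : unitInterval) :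
    leCamDiv 0 (bern a) fairCoin = ENNReal.ofReal ((2 * (a : ℝ) - 1) ^ 2) := by
  set g : Bool → ℝ≥0∞ := fun b => ENNReal.ofReal (2 * if b then (a : ℝ) else 1 - a) with hg
  have ha1 : 0 ≤ 1 - (a : ℝ) := sub_nonneg.2 a.2.2
  have ha0 : 0 ≤ (a : ℝ) := a.2.1
  have he : bern a = fairCoin.withDensity g := by
    refine measure_bool_ext ?_ ?_ <;>
      rw [withDensity_apply _ (measurableSet_singleton _), lintegral_singleton, fairCoin]
    · rw [bern_apply_true, bern_apply_true, ← ENNReal.ofReal_mul (by simpa using ha0)]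
      congr 1
      simp only [if_true]
      ring
    · rw [bern_apply_false, bern_apply_false, ← ENNReal.ofReal_mul (by simpa using ha1)]
      congr 1
      norm_num
      ring
  have hac : bern a ≪ fairCoin := he ▸ withDensity_absolutelyContinuous _ _
  have hrn := Measure.rnDeriv_withDensity fairCoin (measurable_of_finite g)
  rw [← he] at hrn
  have hcongr : ∫⁻ b, ENNReal.ofReal ((((bern a).rnDeriv fairCoin b).toReal - 1) ^ 2) ∂fairCoin
      = ∫⁻ b, ENNReal.ofReal (((g b).toReal - 1) ^ 2) ∂fairCoin := by
    refine lintegral_congr_ae ?_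
    filter_upwards [hrn] with b hb
    rw [hb]
  rw [leCamDiv_zero_of_ac hac, hcongr, fairCoin, lintegral_bern, ← ENNReal.ofReal_mul (sq_nonneg _),
    ← ENNReal.ofReal_mul (sq_nonneg _), ← ENNReal.ofReal_add (by positivity)
      (mul_nonneg (sq_nonneg _) (by norm_num))]
  congr 1
  simp only [hg, if_true, Bool.false_eq_true, if_false]
  rw [ENNReal.toReal_ofReal (by positivity), ENNReal.toReal_ofReal (by positivity)]
  ring

instance (ε : ℝ) : IsMarkovKernel (randomizedResponse ε) := by
  refine ⟨fun b => ?_⟩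
  change IsProbabilityMeasure (if b then bern (rrParam ε) else bern (unitInterval.symm (rrParam ε)))
  split_ifs <;> infer_instance

theorem randomizedResponse_true (ε : ℝ) : randomizedResponse ε true = bern (rrParam ε) := rfl

theorem randomizedResponse_false (ε : ℝ) :
    randomizedResponse ε false = bern (unitInterval.symm (rrParam ε)) := rfl

theorem coe_rrParam (ε : ℝ) : (rrParam ε : ℝ) = Real.exp ε / (1 + Real.exp ε) := rfl

theorem one_sub_rrParam (ε : ℝ) : 1 - (rrParam ε : ℝ) = 1 / (1 + Real.exp ε) := by
  have := Real.exp_pos ε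
  rw [coe_rrParam]
  field_simp
  ring

theorem isLDP_randomizedResponse {ε : ℝ} (hε : 0 ≤ ε) : IsLDP ε (randomizedResponse ε) := by
  have hE : 1 ≤ Real.exp ε := Real.one_le_exp hε
  have hE0 := Real.exp_pos ε
  have hle : ∀ b x x', randomizedResponse ε x {b}
      ≤ ENNReal.ofReal (Real.exp ε) * randomizedResponse ε x' {b} := by
    -- The two output probabilities have ratio exactly e^ε, so the privacy constraint is tight.
    have k0 : Real.exp ε * (1 - rrParam ε) = rrParam ε := by
      rw [one_sub_rrParam, coe_rrParam]; ring
    have k1 : 0 ≤ 1 - (rrParam ε : ℝ) := sub_nonneg.2 (rrParam ε).2.2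
    have k2 := mul_le_mul_of_nonneg_right hE (rrParam ε).2.1
    have k3 := mul_le_mul_of_nonneg_right hE k1
    intro b x x'
    cases b <;> cases x <;> cases x' <;>
      simp only [randomizedResponse_true, randomizedResponse_false, bern_apply_true,
        bern_apply_false, ← ENNReal.ofReal_mul hE0.le, unitInterval.coe_symm_eq,
        sub_sub_cancel] <;>
      refine ENNReal.ofReal_le_ofReal ?_ <;> linarith
  intro A _ x x'
  refine Measure.le_iff'.1 (?_ : randomizedResponse ε x
    ≤ ENNReal.ofReal (Real.exp ε) • randomizedResponse ε x') A
  refine Measure.le_iff.2 fun s _ => ?_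
  rw [← Set.toFinite s |>.coe_toFinset, ← sum_measure_singleton, ← sum_measure_singleton]
  exact Finset.sum_le_sum fun b _ => hle b x x'

/-- The success probability of the output of randomized response with input `Bernoulli(a)`. -/
noncomputable def rrOutput (ε : ℝ) (a : unitInterval) : unitInterval :=
  ⟨a * rrParam ε + (1 - a) * (1 - rrParam ε),
    add_nonneg (mul_nonneg a.2.1 (rrParam ε).2.1)
      (mul_nonneg (sub_nonneg.2 a.2.2) (sub_nonneg.2 (rrParam ε).2.2)), by
    nlinarith [a.2.1, a.2.2, (rrParam ε).2.1, (rrParam ε).2.2]⟩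

theorem coe_rrOutput (ε : ℝ) (a : unitInterval) :
    (rrOutput ε a : ℝ) = a * rrParam ε + (1 - a) * (1 - rrParam ε) := rfl

theorem randomizedResponse_comp_bern (ε : ℝ) (a : unitInterval) :
    randomizedResponse ε ∘ₘ bern a = bern (rrOutput ε a) := by
  have ha0 : 0 ≤ (a : ℝ) := a.2.1
  have ha1 : 0 ≤ 1 - (a : ℝ) := sub_nonneg.2 a.2.2
  have hk0 : 0 ≤ (rrParam ε : ℝ) := (rrParam ε).2.1
  have hk1 : 0 ≤ 1 - (rrParam ε : ℝ) := sub_nonneg.2 (rrParam ε).2.2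
  refine measure_bool_ext ?_ ?_ <;>
    rw [Measure.bind_apply (measurableSet_singleton _) (Kernel.aemeasurable _), lintegral_bern,
      randomizedResponse_true, randomizedResponse_false]
  · simp only [bern_apply_true, unitInterval.coe_symm_eq]
    rw [← ENNReal.ofReal_mul hk0, ← ENNReal.ofReal_mul hk1,
      ← ENNReal.ofReal_add (by positivity) (by positivity), coe_rrOutput]
    congr 1
    ring
  · simp only [bern_apply_false, unitInterval.coe_symm_eq, sub_sub_cancel]
    rw [← ENNReal.ofReal_mul hk0, ← ENNReal.ofReal_mul hk1,
      ← ENNReal.ofReal_add (by positivity) (by positivity), coe_rrOutput]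
    congr 1
    ring

theorem randomizedResponse_comp_fairCoin (ε : ℝ) :
    randomizedResponse ε ∘ₘ fairCoin = fairCoin := by
  rw [fairCoin, randomizedResponse_comp_bern]
  congr 1
  refine Subtype.ext ?_
  rw [coe_rrOutput]
  ring

theorem fDiv_fChiSq_bern_fairCoin (a : unitInterval) :
    fDiv fChiSq (bern a) fairCoin = ENNReal.ofReal ((2 * (a : ℝ) - 1) ^ 2) := by
  rw [fDiv_fChiSq, leCamDiv_bern_fairCoin]

/-- The fair coin is invariant, and the bias 2a - 1 is multiplied by 2κ - 1 = (e^ε - 1) / (e^ε + 1);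
χ² against the fair coin is the squared bias. -/
theorem fDiv_fChiSq_randomizedResponse (ε : ℝ) (a : unitInterval) :
    fDiv fChiSq (randomizedResponse ε ∘ₘ bern a) (randomizedResponse ε ∘ₘ fairCoin)
      = ENNReal.ofReal (Upsilon ε) * fDiv fChiSq (bern a) fairCoin := by
  have hE0 := Real.exp_pos ε
  rw [randomizedResponse_comp_fairCoin, randomizedResponse_comp_bern, fDiv_fChiSq_bern_fairCoin,
    fDiv_fChiSq_bern_fairCoin, ← ENNReal.ofReal_mul (by unfold Upsilon; positivity)]
  congr 1
  rw [Upsilon, coe_rrOutput, one_sub_rrParam, coe_rrParam, ← mul_pow]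
  congr 1
  field_simp
  ring

/-- The point mass at `true` against the fair coin has χ² equal to 1, so its output divergence is
itself the quotient. -/
theorem Upsilon_le_contractionCoeff (ε : ℝ) :
    ENNReal.ofReal (Upsilon ε) ≤ contractionCoeff fChiSq (randomizedResponse ε) := by
  have hD : fDiv fChiSq (bern 1) fairCoin = 1 := by
    rw [fDiv_fChiSq_bern_fairCoin]; norm_num
  have hne : bern 1 ≠ fairCoin := by
    intro h
    rw [← h, fDiv_fChiSq, leCamDiv_self] at hD
    exact zero_ne_one hD
  have h := fDiv_fChiSq_randomizedResponse ε 1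
  refine le_iSup_of_le (bern 1) (le_iSup_of_le fairCoin (le_iSup_of_le inferInstance
    (le_iSup_of_le inferInstance (le_iSup_of_le hne ?_))))
  rw [h, hD, mul_one, div_one]

end LDP

theorem theorem1 (ε : ℝ) (hε : 0 ≤ ε) :
    (∀ (X : Type*) (Z : Type*) [MeasurableSpace X] [MeasurableSpace Z]
        (K : Kernel X Z) [IsMarkovKernel K], LDP.IsLDP ε K →
        LDP.contractionCoeff LDP.fKL K = LDP.contractionCoeff LDP.fChiSq K ∧
        LDP.contractionCoeff LDP.fChiSq K = LDP.contractionCoeff LDP.fHellinger K ∧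
        LDP.contractionCoeff LDP.fHellinger K ≤ ENNReal.ofReal (LDP.Upsilon ε)) ∧
    (IsMarkovKernel (LDP.randomizedResponse ε) ∧
      LDP.IsLDP ε (LDP.randomizedResponse ε) ∧
      LDP.contractionCoeff LDP.fKL (LDP.randomizedResponse ε)
        = ENNReal.ofReal (LDP.Upsilon ε) ∧
      LDP.contractionCoeff LDP.fChiSq (LDP.randomizedResponse ε)
        = ENNReal.ofReal (LDP.Upsilon ε) ∧
      LDP.contractionCoeff LDP.fHellinger (LDP.randomizedResponse ε)
        = ENNReal.ofReal (LDP.Upsilon ε) ∧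
      ∀ α : unitInterval,
        LDP.fDiv LDP.fChiSq (LDP.bern α) LDP.fairCoin
          = ENNReal.ofReal ((2 * (α : ℝ) - 1) ^ 2) ∧
        LDP.fDiv LDP.fChiSq (LDP.randomizedResponse ε ∘ₘ LDP.bern α)
            (LDP.randomizedResponse ε ∘ₘ LDP.fairCoin)
          = ENNReal.ofReal (LDP.Upsilon ε)
            * LDP.fDiv LDP.fChiSq (LDP.bern α) LDP.fairCoin) := by
  refine ⟨fun X Z _ _ K _ hK => ?_, inferInstance, LDP.isLDP_randomizedResponse hε, ?_⟩
  · have hKL := hK.contractionCoeff_fKL hε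
    have hH := hK.contractionCoeff_fHellinger hε
    exact ⟨hKL, hH.symm, hH ▸ hK.contractionCoeff_fChiSq_le hε⟩
  · have hK := LDP.isLDP_randomizedResponse hε
    have hχ : LDP.contractionCoeff LDP.fChiSq (LDP.randomizedResponse ε)
        = ENNReal.ofReal (LDP.Upsilon ε) :=
      le_antisymm (hK.contractionCoeff_fChiSq_le hε) (LDP.Upsilon_le_contractionCoeff ε)
    exact ⟨(hK.contractionCoeff_fKL hε).trans hχ, hχ,
      (hK.contractionCoeff_fHellinger hε).trans hχ, fun α =>
        ⟨LDP.fDiv_fChiSq_bern_fairCoin α, LDP.fDiv_fChiSq_randomizedResponse ε α⟩⟩
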